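/- Let $a_1,\dots,a_n\in\mathbb{D}=\{z\in\mathbb{C}:|z|<1\}$ (not necessarily distinct), let $B(z)=\prod_{k=1}^n\frac{z-a_k}{1-\overline{a_k}z}$ be the monic Blaschke product with these zeros, and assume $B'(0)\neq 0$. Let $\alpha\in[-\pi,\pi)$ be the argument of $B(1)$, i.e. $B(1)=e^{i\alpha}$, and write $\zeta^*=1/\overline{\zeta}$ for $\zeta\ne 0$. (i) The critical points of $B$ can be listed as $\zeta_1,\dots,\zeta_{n-1}\in\mathbb{D}\setminus\{0\}$ together with $\zeta_1^*,\dots,\zeta_{n-1}^*$: at every $z\in\mathbb{C}$ that is not a pole of $B$, the multiplicity of $z$ as a zero of $B'$ is the number of times that $z$ occurs in the list $\zeta_1,\dots,\zeta_{n-1},\zeta_1^*,\dots,\zeta_{n-1}^*$. Let $$A=\{(\tau_1,\dots,\tau_n)\in\mathbb{R}^n:\ \tau_1<\tau_2<\dots<\tau_n<\tau_1+2\pi\}.$$ (ii) There is a continuously differentiable map $T=(\tau_1,\dots,\tau_n):\mathbb{R}\to\mathbb{R}^n$ with strictly increasing coordinates such that $T(\delta)\in A$ and $B(e^{i\tau_j(\delta)})=e^{i\delta}$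 for all $\delta\in\mathbb{R}$ and $1\le j\le n$, and $\tau_1(\alpha)=0$. For any such $\zeta_k$ and $T$ put $$S=\{T(\delta):\delta\in[\alpha,\alpha+2n\pi)\},\qquad S_{\mathbb{R}}=\{T(\delta):\delta\in\mathbb{R}\},\qquad Q=\prod_{j=1}^n[\tau_j(\alpha),\tau_j(\alpha)+2\pi),$$ $$W(w_1,\dots,w_n)=\sum_{k=1}^{n-1}\sum_{j=1}^n\log|(w_j-\zeta_k)(w_j-\zeta_k^*)|-2\sum_{1\le j<k\le n}\log|w_j-w_k|$$ and $\widetilde W(\tau_1,\dots,\tau_n)=W(e^{i\tau_1},\dots,e^{i\tau_n})$ for $\tau_1,\dots,\tau_n\in\mathbb{R}$, where $\widetilde W=+\infty$ if two of the points $e^{i\tau_j}$ coincide. Then: (iii) At every point $\tau\in A\cap Q$ the function $\widetilde W$ is differentiable, and $\nabla\widetilde W(\tau)=0$ if and only if $\tau\in S$, i.e. $\tau=T(\delta)$ for some $\delta\in[\alpha,\alpha+2n\pi)$. (iv) Every point of $S_{\mathbb{R}}$ is a global minimum point of $\widetilde W$ on $\mathbb{R}^n$. -/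

import Mathlib

open scoped ComplexConjugate

noncomputable section

/-- The monic Blaschke product with zeros `a 0, …, a (n-1)`. -/
def blaschke {n : ℕ} (a : Fin n → ℂ) (z : ℂ) : ℂ :=
  ∏ k, (z - a k) / (1 - conj (a k) * z)

/-- The reflection `ζ^* = 1 / conj ζ` of `ζ ≠ 0` in the unit circle. -/
def circleReflection (ζ : ℂ) : ℂ := 1 / conj ζ

/-- `ζ_1, …, ζ_{n-1} ∈ 𝔻 \ {0}` and their reflections list the critical points of the Blaschke
product: at every point that is not a pole of `B`, the multiplicity of the zero of `B'` (which is
`0` where `B'` does not vanish) is the number of times that the point occurs in the list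
`ζ_1, …, ζ_{n-1}, ζ_1^*, …, ζ_{n-1}^*`. -/
structure IsCriticalList {n : ℕ} (a : Fin n → ℂ) (ζ : Fin (n - 1) → ℂ) : Prop where
  norm_lt_one : ∀ k, ‖ζ k‖ < 1
  ne_zero : ∀ k, ζ k ≠ 0
  order_eq : ∀ z : ℂ, (∀ k, 1 - conj (a k) * z ≠ 0) →
    analyticOrderAt (deriv (blaschke a)) z =
      (({k | ζ k = z} : Finset (Fin (n - 1))).card +
        ({k | circleReflection (ζ k) = z} : Finset (Fin (n - 1))).card : ℕ)

/-- The set `A` of the points with `τ_1 < τ_2 < ⋯ < τ_n < τ_1 + 2π`. -/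
def orderedAngles (n : ℕ) : Set (EuclideanSpace ℝ (Fin n)) :=
  {τ | (∀ j k, j < k → τ j < τ k) ∧ ∀ j k, τ k < τ j + 2 * Real.pi}

/-- The defining properties of the parametrization `T = (τ_1, …, τ_n)` of the solutions of
`B(e^{iτ}) = e^{iδ}`, with the labelling normalized by `τ_1(α) = 0`. -/
structure IsSolutionPath {n : ℕ} (a : Fin n → ℂ) (α : ℝ)
    (T : ℝ → EuclideanSpace ℝ (Fin n)) : Prop where
  contDiff : ContDiff ℝ 1 T
  strictMono : ∀ j, StrictMono fun δ => T δ j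
  mem_orderedAngles : ∀ δ, T δ ∈ orderedAngles n
  solution : ∀ δ j, blaschke a (Complex.exp (T δ j * Complex.I)) = Complex.exp (δ * Complex.I)
  first_eq_zero : ∀ j : Fin n, (j : ℕ) = 0 → T α j = 0

/-- The box `Q = ∏_j [τ_j(α), τ_j(α) + 2π)`. -/
def solutionBox {n : ℕ} (α : ℝ) (T : ℝ → EuclideanSpace ℝ (Fin n)) :
    Set (EuclideanSpace ℝ (Fin n)) :=
  {τ | ∀ j, τ j ∈ Set.Ico (T α j) (T α j + 2 * Real.pi)}

/-- The (doubled) energy `W` of electrons at pairwise distinct points `w_1, …, w_n`, in the field of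
protons of charge `1/2` at `ζ_k` and `ζ_k^*`. -/
def energy {n : ℕ} (ζ : Fin (n - 1) → ℂ) (w : Fin n → ℂ) : ℝ :=
  (∑ k, ∑ j, Real.log ‖(w j - ζ k) * (w j - circleReflection (ζ k))‖)
    - 2 * ∑ j, ∑ k ∈ Finset.Ioi j, Real.log ‖w j - w k‖

/-- The points `(e^{iτ_1}, …, e^{iτ_n})` of the unit circle. -/
def circlePoints {n : ℕ} (τ : EuclideanSpace ℝ (Fin n)) (j : Fin n) : ℂ :=
  Complex.exp (τ j * Complex.I)

/-- The restricted energy `W̃(τ) = W(e^{iτ_1}, …, e^{iτ_n})`, where the electrons are distinct. -/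
def circleEnergy {n : ℕ} (ζ : Fin (n - 1) → ℂ) (τ : EuclideanSpace ℝ (Fin n)) : ℝ :=
  energy ζ (circlePoints τ)

open Classical in
/-- The restricted energy on all of `ℝⁿ`, with its value `+∞` where two electrons coincide
(`log 0 = -∞`). -/
def extendedCircleEnergy {n : ℕ} (ζ : Fin (n - 1) → ℂ) (τ : EuclideanSpace ℝ (Fin n)) : EReal :=
  if Function.Injective (circlePoints τ) then (circleEnergy ζ τ : EReal) else ⊤

end

/-! Write `P = ∏ (X - a_k)` and `D = ∏ (1 - conj a_k X)`, so that `B = P / D` and `B' = N / D ^ 2`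
with the Wronskian `N = P' D - P D'`, the polynomial `critPoly a`. It is also equal to
`∑ (1 - |a_k|²) ∏_{j ≠ k} (X - a_j) (1 - conj a_j X)`, which shows that it is invariant under
reflection in the unit circle and that `N(z) / z ^ (n - 1)` is positive there. Since `N(0) ≠ 0`, the
roots of `N` are `n - 1` points of the punctured disk together with their reflections, and on the
circle the energy of distinct points `w` is `∑ log |N(w_j)| - 2 ∑ log |w_j - w_k|` up to a constant.

Call distinct points `w_j` of the circle an equilibrium if `N'(w_j) / N(w_j) = 2 ∑ 1 / (w_j - w_k)`
for all `j`. The gradient of the energy vanishes exactly at equilibria, because the other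
(radial) component of these equations holds automatically by reflection. The level sets of `B` on
the circle are equilibria: `q = P - λ D` is a multiple of `∏ (X - w_j)` and `N = q' D - q D'`.

For an equilibrium, Hermite interpolation gives `N = ∑ N(w_j) ℓ_j²` with the Lagrange polynomials
`ℓ_j`, and on the circle all terms have the same argument, so that
`|N(z)| = ∑ |N(w_j)| |ℓ_j(z)|²` (`IsEquilibrium.sum_norm_basis`). Hence, for further points `v_i` of
the circle, the matrix with entries `ℓ_j(v_i) √(|N(w_j)| / |N(v_i)|)` has unit rows. By Hadamard's
inequality its determinant, which is a quotient of Vandermonde determinants up to the factors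
`|N|`, is at most `1` in absolute value. This says that the energy at `w` is at most the energy
at `v` (`IsEquilibrium.energy_le`): every equilibrium is a global minimum, in particular every level
set of `B`. Conversely, compare an equilibrium `v` with the level set `w` of `B` through `v_0`. Both
are minima, so the rows of the matrix are orthonormal; row `0` is a unit coordinate vector, so
`ℓ_0(v_i) = 0` for `i ≠ 0`, and all `v_i` belong to the level set `w`.

The path `T` comes from the increasing lift `blaschkeAngle` of the argument of `B` to the real
line. -/

/-! ### Hadamard's inequality for unit rows -/

open scoped ComplexOrder in
/-- **Hadamard's inequality** for a matrix `G` with rows of norm `1`, with the case of equality. The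
eigenvalues of `G Gᴴ` have sum `n` and product `|det G| ^ 2`, so this is the bound
`x ≤ exp (x - 1)` at each of them. -/
theorem norm_det_le_one_of_rows {n : ℕ} (G : Matrix (Fin n) (Fin n) ℂ)
    (hG : ∀ i, ∑ j, ‖G i j‖ ^ 2 = 1) :
    ‖G.det‖ ≤ 1 ∧ (‖G.det‖ = 1 → G * G.conjTranspose = 1) := by
  have hps : (G * G.conjTranspose).PosSemidef := Matrix.posSemidef_self_mul_conjTranspose G
  have hH := hps.isHermitian
  set l := hH.eigenvalues with hl
  have hl0 : ∀ i, 0 ≤ l i := hps.eigenvalues_nonneg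
  have hdet : ‖G.det‖ ^ 2 = ∏ i, l i := by
    have h := hH.det_eq_prod_eigenvalues
    rw [Matrix.det_mul, Matrix.det_conjTranspose] at h
    have h2 : G.det * star G.det = ((‖G.det‖ ^ 2 : ℝ) : ℂ) := by
      rw [Complex.star_def, Complex.mul_conj, Complex.normSq_eq_norm_sq]
    rw [h2] at h
    refine Complex.ofReal_injective (h.trans ?_)
    rw [Complex.ofReal_prod]
    rfl
  have htr : ∑ i, (l i - 1) = 0 := by
    have h := hH.trace_eq_sum_eigenvalues
    have h2 : (G * G.conjTranspose).trace = (n : ℂ) := by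
      simp only [Matrix.trace, Matrix.diag_apply, Matrix.mul_apply, Matrix.conjTranspose_apply]
      have : ∀ i, ∑ j, G i j * star (G i j) = 1 := by
        intro i
        have := congrArg (fun x : ℝ => (x : ℂ)) (hG i)
        push_cast at this
        rw [← this]
        refine Finset.sum_congr rfl fun j _ => ?_
        rw [Complex.star_def, Complex.mul_conj, Complex.normSq_eq_norm_sq]; push_cast; rfl
      rw [Finset.sum_congr rfl fun i _ => this i]; simp
    rw [h2] at h
    have h3 : (n : ℝ) = ∑ i, l i := by
      refine Complex.ofReal_injective ((Complex.ofReal_natCast n).trans (h.trans ?_))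
      rw [Complex.ofReal_sum]
      rfl
    simp [← h3]
  have hle : ‖G.det‖ ^ 2 ≤ 1 := by
    rw [hdet]
    calc ∏ i, l i ≤ ∏ i, Real.exp (l i - 1) :=
          Finset.prod_le_prod (fun i _ => hl0 i) fun i _ => by
            have := Real.add_one_le_exp (l i - 1); linarith
      _ = 1 := by rw [← Real.exp_sum, htr, Real.exp_zero]
  refine ⟨by nlinarith [norm_nonneg G.det], fun h1 => ?_⟩
  have hprod : ∏ i, l i = 1 := by rw [← hdet, h1]; norm_num
  have hpos : ∀ i, 0 < l i := fun i => lt_of_le_of_ne (hl0 i) fun h => by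
    rw [Finset.prod_eq_zero (Finset.mem_univ i) h.symm] at hprod
    exact zero_ne_one hprod
  have hlog : ∑ i, Real.log (l i) = ∑ i, (l i - 1) := by
    rw [htr, ← Real.log_prod fun i _ => (hpos i).ne', hprod, Real.log_one]
  have heq := (Finset.sum_eq_sum_iff_of_le
    fun i _ => Real.log_le_sub_one_of_pos (hpos i)).1 hlog
  have hone : ∀ i, l i = 1 := fun i => by
    by_contra hne
    exact (Real.log_lt_sub_one_of_pos (hpos i) hne).ne (heq i (Finset.mem_univ i))
  have hsp := hH.spectral_theorem
  rw [hsp]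
  have : (RCLike.ofReal ∘ hH.eigenvalues : Fin n → ℂ) = 1 := by
    funext i
    change ((l i : ℝ) : ℂ) = 1
    rw [hone]; simp
  rw [this]
  simp

/-! ### Interpolation at an equilibrium on the unit circle -/

open Polynomial in
/-- Hermite interpolation: at `w j` the polynomials `N` and `∑ N(w_j) ℓ_j²` have the same value, and
by the hypothesis also the same derivative, since `ℓ_j'(w_j) = ∑ 1 / (w_j - w_k)`. Both have degree
less than `2 n`. -/
theorem eq_sum_sq_basis {n : ℕ} (N : ℂ[X]) (hN : N.degree < (2 * n : ℕ)) (w : Fin n → ℂ)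
    (hw : Function.Injective w)
    (h : ∀ j, N.derivative.eval (w j) =
      2 * N.eval (w j) * ∑ k ∈ Finset.univ.erase j, 1 / (w j - w k)) :
    N = ∑ j, C (N.eval (w j)) * Lagrange.basis Finset.univ w j ^ 2 := by
  classical
  have hinj : Set.InjOn w (Finset.univ : Finset (Fin n)) := hw.injOn
  set D := N - ∑ j, C (N.eval (w j)) * Lagrange.basis Finset.univ w j ^ 2 with hD
  have hself : ∀ j, (Lagrange.basis Finset.univ w j).eval (w j) = 1 := fun j =>
    Lagrange.eval_basis_self hinj (Finset.mem_univ j)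
  have hne : ∀ i j, i ≠ j → (Lagrange.basis Finset.univ w i).eval (w j) = 0 := fun i j hij =>
    Lagrange.eval_basis_of_ne hij (Finset.mem_univ j)
  have hder : ∀ j, (Lagrange.basis Finset.univ w j).derivative.eval (w j) =
      ∑ k ∈ Finset.univ.erase j, 1 / (w j - w k) := by
    intro j
    rw [Lagrange.basis, derivative_prod_finset, eval_finsetSum]
    refine Finset.sum_congr rfl fun k hk => ?_
    have hk' : w j ≠ w k := fun e => (Finset.ne_of_mem_erase hk) (hw e).symm
    rw [eval_mul, eval_prod, Finset.prod_eq_one]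
    · simp [Lagrange.basisDivisor]
    · intro l hl
      exact Lagrange.eval_basisDivisor_left_of_ne fun e =>
        (Finset.ne_of_mem_erase (Finset.mem_of_mem_erase hl)) (hw e).symm
  have hD0 : ∀ j, D.eval (w j) = 0 := by
    intro j
    rw [hD, eval_sub, eval_finsetSum, Finset.sum_eq_single j]
    · simp [hself]
    · intro b _ hb; simp [hne b j hb]
    · simp
  have hD1 : ∀ j, D.derivative.eval (w j) = 0 := by
    intro j
    rw [hD, derivative_sub, eval_sub, derivative_sum, eval_finsetSum, Finset.sum_eq_single j]
    · simp [hself, hder, h, derivative_pow]; ring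
    · intro b _ hb; simp [hne b j hb, derivative_pow]
    · simp
  have hdvd : (∏ j, (X - C (w j)) ^ 2) ∣ D := by
    refine Finset.prod_dvd_of_coprime ?_ fun j _ => ?_
    · intro i _ j _ hij
      exact (pairwise_coprime_X_sub_C hw hij).pow
    · by_cases hz : D = 0
      · simp [hz]
      · rw [← le_rootMultiplicity_iff hz]
        exact (one_lt_rootMultiplicity_iff_isRoot hz).2 ⟨hD0 j, hD1 j⟩
  have hdeg : D.degree < (2 * n : ℕ) := by
    refine lt_of_le_of_lt (degree_sub_le _ _) (max_lt hN ?_)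
    refine lt_of_le_of_lt (degree_sum_le _ _) ?_
    rw [Finset.sup_lt_iff (by exact WithBot.bot_lt_coe _)]
    intro j _
    have hn : 0 < n := j.pos
    refine lt_of_le_of_lt ((degree_mul_le _ _).trans (add_le_add_left degree_C_le _)) ?_
    rw [zero_add, degree_pow, Lagrange.degree_basis hinj (Finset.mem_univ j)]
    simp only [Finset.card_univ, Fintype.card_fin, nsmul_eq_mul]
    norm_cast
    omega
  have hDz : D = 0 := by
    refine eq_zero_of_dvd_of_degree_lt hdvd (lt_of_lt_of_eq hdeg ?_)
    rw [degree_prod]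
    simp [degree_pow]
    ring
  exact sub_eq_zero.1 hDz

/-- Interpolation of the monomials `X ^ m`, `m < n`, at the nodes `w`, in matrix form. -/
theorem det_vandermonde_eq {n : ℕ} (v w : Fin n → ℂ) (hw : Function.Injective w) :
    (Matrix.vandermonde v).det =
      (Matrix.of fun i j => (Lagrange.basis Finset.univ w j).eval (v i)).det *
        (Matrix.vandermonde w).det := by
  rw [← Matrix.det_mul]
  congr 1
  ext i m
  have hinj : Set.InjOn w (Finset.univ : Finset (Fin n)) := hw.injOn
  have := Lagrange.eq_interpolate (f := (Polynomial.X ^ (m : ℕ) : Polynomial ℂ)) hinj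
    (by rw [Polynomial.degree_X_pow]; simp)
  have := congrArg (Polynomial.eval (v i)) this
  rw [Lagrange.interpolate_apply, Polynomial.eval_finsetSum] at this
  simpa [Matrix.mul_apply, Matrix.vandermonde_apply, mul_comm] using this

theorem sub_sq_of_norm_eq_one {z w : ℂ} (hz : ‖z‖ = 1) (hw : ‖w‖ = 1) :
    (z - w) ^ 2 = -(((‖z - w‖ ^ 2 : ℝ) : ℂ) * (z * w)) := by
  have hz0 : z ≠ 0 := fun h => by simp [h] at hz
  have hw0 : w ≠ 0 := fun h => by simp [h] at hw
  rw [← Complex.normSq_eq_norm_sq, ← Complex.mul_conj, map_sub,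
    ← Complex.inv_eq_conj hz, ← Complex.inv_eq_conj hw]
  field_simp
  ring

/-- On the unit circle, `ℓ_j(z)²` has the argument of `(z / w_j) ^ (n - 1)`. -/
theorem basis_sq_mul_pow {n : ℕ} {w : Fin n → ℂ} (hw : Function.Injective w)
    (hw1 : ∀ j, ‖w j‖ = 1) {z : ℂ} (hz : ‖z‖ = 1) (j : Fin n) :
    (Lagrange.basis Finset.univ w j).eval z ^ 2 * w j ^ (n - 1) =
      ((‖(Lagrange.basis Finset.univ w j).eval z‖ ^ 2 : ℝ) : ℂ) * z ^ (n - 1) := by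
  have hcard : (Finset.univ.erase j).card = n - 1 := by simp
  rw [Lagrange.basis, Polynomial.eval_prod, norm_prod, ← Finset.prod_pow, ← Finset.prod_pow,
    ← hcard, ← Finset.prod_const, ← Finset.prod_const, ← Finset.prod_mul_distrib,
    Complex.ofReal_prod, ← Finset.prod_mul_distrib]
  refine Finset.prod_congr rfl fun k hk => ?_
  have hne : w j - w k ≠ 0 := sub_ne_zero.2 fun e => (Finset.ne_of_mem_erase hk) (hw e).symm
  have hj0 : w j ≠ 0 := fun h => by have := hw1 j; simp [h] at this
  have hk0 : w k ≠ 0 := fun h => by have := hw1 k; simp [h] at this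
  have hn : ((‖w j - w k‖ : ℝ) : ℂ) ≠ 0 := by exact_mod_cast norm_ne_zero_iff.2 hne
  simp only [Lagrange.basisDivisor, Polynomial.eval_mul, Polynomial.eval_C, Polynomial.eval_sub,
    Polynomial.eval_X, norm_mul, norm_inv, mul_pow, inv_pow]
  rw [sub_sq_of_norm_eq_one hz (hw1 k), sub_sq_of_norm_eq_one (hw1 j) (hw1 k)]
  push_cast
  field_simp

/-- The logarithmic derivative of `N` balances the mutual repulsion of the points `w j`; here `N` is
a polynomial whose zeros are the fixed charges. The equation is multiplied by `N(w_j)`. -/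
def IsEquilibrium {n : ℕ} (N : Polynomial ℂ) (w : Fin n → ℂ) : Prop :=
  ∀ j, N.derivative.eval (w j) =
    2 * N.eval (w j) * ∑ k ∈ Finset.univ.erase j, 1 / (w j - w k)

/-- `N` has degree less than `2 n` and no zero on the unit circle, where `N(z) / z ^ (n - 1)` is
positive. -/
structure IsCirclePositive (n : ℕ) (N : Polynomial ℂ) : Prop where
  degree_lt : N.degree < (2 * n : ℕ)
  eval_ne_zero : ∀ z : ℂ, ‖z‖ = 1 → N.eval z ≠ 0
  eval_eq : ∀ z : ℂ, ‖z‖ = 1 → N.eval z = ‖N.eval z‖ * z ^ (n - 1)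

/-- The interpolation formula `N = ∑ N(w_j) ℓ_j²` at a point of the unit circle, where by
positivity of `N` no cancellation occurs. -/
theorem IsEquilibrium.sum_norm_basis {n : ℕ} {N : Polynomial ℂ} {w : Fin n → ℂ}
    (h : IsEquilibrium N w) (hN : IsCirclePositive n N) (hw : Function.Injective w)
    (hw1 : ∀ j, ‖w j‖ = 1) {z : ℂ} (hz : ‖z‖ = 1) :
    ∑ j, ‖N.eval (w j)‖ * ‖(Lagrange.basis Finset.univ w j).eval z‖ ^ 2 = ‖N.eval z‖ := by
  have hz0 : z ^ (n - 1) ≠ 0 := pow_ne_zero _ fun h => by simp [h] at hz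
  have h1 := congrArg (Polynomial.eval z) (eq_sum_sq_basis N hN.degree_lt w hw h)
  rw [Polynomial.eval_finsetSum, hN.eval_eq z hz] at h1
  have h2 : ∀ j, (Polynomial.C (N.eval (w j)) * Lagrange.basis Finset.univ w j ^ 2).eval z =
      ((‖N.eval (w j)‖ * ‖(Lagrange.basis Finset.univ w j).eval z‖ ^ 2 : ℝ) : ℂ) *
        z ^ (n - 1) := by
    intro j
    have := basis_sq_mul_pow hw hw1 hz j
    rw [Polynomial.eval_mul, Polynomial.eval_pow, Polynomial.eval_C, Complex.ofReal_mul]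
    conv_lhs => rw [hN.eval_eq _ (hw1 j)]
    linear_combination (‖N.eval (w j)‖ : ℂ) * this
  rw [Finset.sum_congr rfl fun j _ => h2 j, ← Finset.sum_mul] at h1
  have h3 := mul_right_cancel₀ hz0 h1
  exact_mod_cast h3.symm

/-- An equilibrium maximizes `∏ |w_j - w_k|² / ∏ |N(w_j)|` among the `n`-tuples of points of the
unit circle. A maximizer `v` that shares a point with `w` in the same position has all of its points
in `w`. -/
theorem IsEquilibrium.norm_det_vandermonde_le {n : ℕ} {N : Polynomial ℂ} {w : Fin n → ℂ}
    (h : IsEquilibrium N w) (hN : IsCirclePositive n N) (hw : Function.Injective w)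
    (hw1 : ∀ j, ‖w j‖ = 1) {v : Fin n → ℂ} (hv1 : ∀ j, ‖v j‖ = 1) :
    (∏ j, ‖N.eval (w j)‖) * ‖(Matrix.vandermonde v).det‖ ^ 2 ≤
        (∏ j, ‖N.eval (v j)‖) * ‖(Matrix.vandermonde w).det‖ ^ 2 ∧
      ((∏ j, ‖N.eval (w j)‖) * ‖(Matrix.vandermonde v).det‖ ^ 2 =
        (∏ j, ‖N.eval (v j)‖) * ‖(Matrix.vandermonde w).det‖ ^ 2 →
        ∀ i₀, v i₀ = w i₀ → ∀ i, v i ∈ Set.range w) := by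
  set L : Matrix (Fin n) (Fin n) ℂ :=
    Matrix.of fun i j => (Lagrange.basis Finset.univ w j).eval (v i) with hL
  set G : Matrix (Fin n) (Fin n) ℂ :=
    Matrix.diagonal (fun i => (((√‖N.eval (v i)‖)⁻¹ : ℝ) : ℂ)) * L *
      Matrix.diagonal (fun j => ((√‖N.eval (w j)‖ : ℝ) : ℂ)) with hGdef
  have hGe : ∀ i j, G i j = (((√‖N.eval (v i)‖)⁻¹ : ℝ) : ℂ) *
      (Lagrange.basis Finset.univ w j).eval (v i) * ((√‖N.eval (w j)‖ : ℝ) : ℂ) := by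
    intro i j
    rw [hGdef, Matrix.mul_diagonal, Matrix.diagonal_mul]
    rfl
  have hvpos : ∀ i, 0 < ‖N.eval (v i)‖ := fun i => norm_pos_iff.2 (hN.eval_ne_zero _ (hv1 i))
  have hwpos : ∀ i, 0 < ‖N.eval (w i)‖ := fun i => norm_pos_iff.2 (hN.eval_ne_zero _ (hw1 i))
  -- The rows of `G` are unit vectors by the interpolation formula at `v i`.
  have hrow : ∀ i, ∑ j, ‖G i j‖ ^ 2 = 1 := by
    intro i
    have h1 := h.sum_norm_basis hN hw hw1 (hv1 i)
    have h2 : ∀ j, ‖G i j‖ ^ 2 = ‖N.eval (v i)‖⁻¹ *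
        (‖N.eval (w j)‖ * ‖(Lagrange.basis Finset.univ w j).eval (v i)‖ ^ 2) := by
      intro j
      rw [hGe, norm_mul, norm_mul, Complex.norm_real, Complex.norm_real, mul_pow, mul_pow,
        norm_inv, inv_pow, Real.norm_of_nonneg (Real.sqrt_nonneg _),
        Real.norm_of_nonneg (Real.sqrt_nonneg _), Real.sq_sqrt (norm_nonneg _),
        Real.sq_sqrt (norm_nonneg _)]
      ring
    rw [Finset.sum_congr rfl fun j _ => h2 j, ← Finset.mul_sum, h1,
      inv_mul_cancel₀ (hvpos i).ne']
  have hdetG : ‖G.det‖ ^ 2 * ∏ j, ‖N.eval (v j)‖ = ‖L.det‖ ^ 2 * ∏ j, ‖N.eval (w j)‖ := by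
    rw [hGdef, Matrix.det_mul, Matrix.det_mul, Matrix.det_diagonal, Matrix.det_diagonal, norm_mul,
      norm_mul, norm_prod, norm_prod, mul_pow, mul_pow, ← Finset.prod_pow, ← Finset.prod_pow]
    have e1 : ∏ i, ‖(((√‖N.eval (v i)‖)⁻¹ : ℝ) : ℂ)‖ ^ 2 = (∏ j, ‖N.eval (v j)‖)⁻¹ := by
      rw [← Finset.prod_inv_distrib]
      refine Finset.prod_congr rfl fun i _ => ?_
      rw [Complex.norm_real, norm_inv, inv_pow, Real.norm_of_nonneg (Real.sqrt_nonneg _),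
        Real.sq_sqrt (norm_nonneg _)]
    have e2 : ∏ i, ‖((√‖N.eval (w i)‖ : ℝ) : ℂ)‖ ^ 2 = ∏ j, ‖N.eval (w j)‖ := by
      refine Finset.prod_congr rfl fun i _ => ?_
      rw [Complex.norm_real, Real.norm_of_nonneg (Real.sqrt_nonneg _),
        Real.sq_sqrt (norm_nonneg _)]
    rw [e1, e2]
    have : ∏ j, ‖N.eval (v j)‖ ≠ 0 := Finset.prod_ne_zero_iff.2 fun i _ => (hvpos i).ne'
    field_simp
  have hvan : ‖(Matrix.vandermonde v).det‖ = ‖L.det‖ * ‖(Matrix.vandermonde w).det‖ := by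
    rw [det_vandermonde_eq v w hw, norm_mul]
  have hw0 : 0 < ‖(Matrix.vandermonde w).det‖ :=
    norm_pos_iff.2 (Matrix.det_vandermonde_ne_zero_iff.2 hw)
  have hv0 : 0 < ∏ j, ‖N.eval (v j)‖ := Finset.prod_pos fun i _ => hvpos i
  obtain ⟨hle, heq⟩ := norm_det_le_one_of_rows G hrow
  have key : (∏ j, ‖N.eval (w j)‖) * ‖(Matrix.vandermonde v).det‖ ^ 2 =
      ‖G.det‖ ^ 2 * ((∏ j, ‖N.eval (v j)‖) * ‖(Matrix.vandermonde w).det‖ ^ 2) := by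
    rw [hvan]; linear_combination (-‖(Matrix.vandermonde w).det‖ ^ 2) * hdetG
  have hK : 0 < (∏ j, ‖N.eval (v j)‖) * ‖(Matrix.vandermonde w).det‖ ^ 2 := by positivity
  rw [key]
  refine ⟨mul_le_of_le_one_left hK.le (pow_le_one₀ (norm_nonneg _) hle), fun h1 i₀ hi₀ i => ?_⟩
  have hG1 : ‖G.det‖ = 1 := by
    have : ‖G.det‖ ^ 2 = 1 := by
      exact mul_right_cancel₀ hK.ne' (by rw [h1, one_mul])
    nlinarith [norm_nonneg G.det]
  by_cases hii : i = i₀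
  · exact ⟨i₀, by rw [hii, hi₀]⟩
  -- Row `i₀` of `G` is supported at `i₀`, so orthogonality of the rows gives `G i i₀ = 0`.
  have horth : (G * G.conjTranspose) i i₀ = 0 := by
    rw [heq hG1, Matrix.one_apply_ne hii]
  have hbasis : ∀ j, j ≠ i₀ → G i₀ j = 0 := fun j hj => by
    rw [hGe, hi₀, Lagrange.eval_basis_of_ne hj (Finset.mem_univ _)]; simp
  have hdiag : G i₀ i₀ ≠ 0 := fun h0 => by
    have := hrow i₀
    rw [Finset.sum_eq_zero] at this
    · exact zero_ne_one this
    · intro j _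
      by_cases hj : j = i₀
      · rw [hj, h0]; simp
      · rw [hbasis j hj]; simp
  rw [Matrix.mul_apply, Finset.sum_eq_single i₀ (fun j _ hj => by simp [hbasis j hj])
    (by simp), Matrix.conjTranspose_apply] at horth
  have h0 := (mul_eq_zero.1 horth).resolve_right (star_ne_zero.2 hdiag)
  rw [hGe] at h0
  have hs1 : (((√‖N.eval (v i)‖)⁻¹ : ℝ) : ℂ) ≠ 0 := by
    exact_mod_cast (inv_pos.2 (Real.sqrt_pos.2 (hvpos i))).ne'
  have hs2 : ((√‖N.eval (w i₀)‖ : ℝ) : ℂ) ≠ 0 := by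
    exact_mod_cast (Real.sqrt_pos.2 (hwpos i₀)).ne'
  have hl := (mul_eq_zero.1 ((mul_eq_zero.1 h0).resolve_right hs2)).resolve_left hs1
  by_contra hr
  have hne : ∀ k, v i - w k ≠ 0 := fun k => sub_ne_zero.2 fun e => hr ⟨k, e.symm⟩
  rw [Lagrange.eval_basis_not_at_node (Finset.mem_univ i₀) (sub_ne_zero.1 (hne i₀)),
    Lagrange.eval_nodal] at hl
  exact mul_ne_zero (Finset.prod_ne_zero_iff.2 fun k _ => hne k)
    (mul_ne_zero (Lagrange.nodalWeight_ne_zero hw.injOn (Finset.mem_univ i₀))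
      (inv_ne_zero (hne i₀))) hl

section Polynomials

/-! ### The numerator of the derivative of a Blaschke product -/

open Polynomial

/-- The numerator `∏ (X - a_k)` of the Blaschke product. -/
noncomputable def blaschkeNum {n : ℕ} (a : Fin n → ℂ) : ℂ[X] := ∏ k, (X - C (a k))

/-- The denominator `∏ (1 - conj a_k X)` of the Blaschke product. -/
noncomputable def blaschkeDen {n : ℕ} (a : Fin n → ℂ) : ℂ[X] := ∏ k, (1 - C (conj (a k)) * X)

/-- The numerator of the derivative of the Blaschke product over the square of its denominator, in
a form that shows its degree, its symmetry and its sign on the unit circle. -/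
noncomputable def critPoly {n : ℕ} (a : Fin n → ℂ) : ℂ[X] :=
  ∑ k, C (1 - conj (a k) * a k) *
    ∏ j ∈ Finset.univ.erase k, ((X - C (a j)) * (1 - C (conj (a j)) * X))

variable {n : ℕ} {a : Fin n → ℂ}

theorem blaschke_eq_div (a : Fin n → ℂ) (z : ℂ) :
    blaschke a z = (blaschkeNum a).eval z / (blaschkeDen a).eval z := by
  simp [blaschke, blaschkeNum, blaschkeDen, eval_prod, Finset.prod_div_distrib]

theorem critPoly_eq_wronskian (a : Fin n → ℂ) :
    critPoly a = derivative (blaschkeNum a) * blaschkeDen a -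
      blaschkeNum a * derivative (blaschkeDen a) := by
  rw [critPoly, blaschkeNum, blaschkeDen, derivative_prod_finset, derivative_prod_finset,
    Finset.sum_mul, Finset.mul_sum, ← Finset.sum_sub_distrib]
  refine Finset.sum_congr rfl fun k hk => ?_
  rw [← Finset.mul_prod_erase _ (fun k => X - C (a k)) hk,
    ← Finset.mul_prod_erase _ (fun k => 1 - C (conj (a k)) * X) hk, Finset.prod_mul_distrib]
  simp only [derivative_X, derivative_C, derivative_one, derivative_mul, map_sub, map_mul,
    map_one]
  ring

theorem eval_blaschkeDen_ne_zero_iff (a : Fin n → ℂ) (z : ℂ) :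
    (blaschkeDen a).eval z ≠ 0 ↔ ∀ k, 1 - conj (a k) * z ≠ 0 := by
  simp [blaschkeDen, eval_prod, Finset.prod_ne_zero_iff]

theorem eval_blaschkeDen_ne_zero (ha : ∀ k, ‖a k‖ < 1) {z : ℂ} (hz : ‖z‖ ≤ 1) :
    (blaschkeDen a).eval z ≠ 0 := by
  rw [eval_blaschkeDen_ne_zero_iff]
  intro k h
  have h1 : ‖conj (a k) * z‖ = 1 := by rw [← sub_eq_zero.1 h, norm_one]
  rw [norm_mul, Complex.norm_conj] at h1
  nlinarith [ha k, norm_nonneg (a k), norm_nonneg z]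

theorem hasDerivAt_blaschke {z : ℂ} (hz : (blaschkeDen a).eval z ≠ 0) :
    HasDerivAt (blaschke a) ((critPoly a).eval z / (blaschkeDen a).eval z ^ 2) z := by
  have h := ((blaschkeNum a).hasDerivAt z).div ((blaschkeDen a).hasDerivAt z) hz
  have e : blaschke a = fun z => (blaschkeNum a).eval z / (blaschkeDen a).eval z :=
    funext (blaschke_eq_div a)
  rw [e, critPoly_eq_wronskian]
  simp only [eval_sub, eval_mul]
  exact h

theorem eval_critPoly_zero_ne_zero (ha : ∀ k, ‖a k‖ < 1) (hB : deriv (blaschke a) 0 ≠ 0) :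
    (critPoly a).eval 0 ≠ 0 := by
  intro h
  apply hB
  rw [(hasDerivAt_blaschke (eval_blaschkeDen_ne_zero ha (by simp))).deriv, h, zero_div]

theorem eval_critPoly (a : Fin n → ℂ) (z : ℂ) : (critPoly a).eval z =
    ∑ k, (1 - conj (a k) * a k) *
      ∏ j ∈ Finset.univ.erase k, ((z - a j) * (1 - conj (a j) * z)) := by
  simp [critPoly, eval_finsetSum, eval_prod]

theorem eval_critPoly_reflect (a : Fin n → ℂ) {z : ℂ} (hz : z ≠ 0) :
    (critPoly a).eval z =
      z ^ (2 * (n - 1)) * conj ((critPoly a).eval (circleReflection z)) := by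
  rw [eval_critPoly, eval_critPoly, map_sum, Finset.mul_sum]
  refine Finset.sum_congr rfl fun k _ => ?_
  have hcard : (Finset.univ.erase k).card = n - 1 := by simp
  rw [pow_mul, ← hcard, ← Finset.prod_const, map_mul, map_prod, mul_left_comm,
    ← Finset.prod_mul_distrib]
  congr 1
  · simp [mul_comm]
  · refine Finset.prod_congr rfl fun j _ => ?_
    simp only [circleReflection, map_mul, map_sub, map_div₀, map_one, Complex.conj_conj]
    field_simp

theorem natDegree_critPoly_le : (critPoly a).natDegree ≤ 2 * (n - 1) := by
  refine natDegree_sum_le_of_forall_le _ _ fun k _ => ?_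
  refine (natDegree_C_mul_le _ _).trans ((natDegree_prod_le _ _).trans ?_)
  refine (Finset.sum_le_card_nsmul _ _ 2 fun j _ => by compute_degree).trans ?_
  simp [mul_comm]

theorem degree_critPoly_lt (hn : 0 < n) : (critPoly a).degree < (2 * n : ℕ) := by
  refine degree_le_natDegree.trans_lt ?_
  have := natDegree_critPoly_le (a := a)
  exact_mod_cast (by omega : (critPoly a).natDegree < 2 * n)

theorem isCirclePositive_critPoly (hn : 0 < n) (ha : ∀ k, ‖a k‖ < 1) :
    IsCirclePositive n (critPoly a) := by
  have key : ∀ z : ℂ, ‖z‖ = 1 → ∃ r : ℝ, 0 < r ∧ (critPoly a).eval z = r * z ^ (n - 1) := by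
    intro z hz
    have hz0 : z ≠ 0 := fun h => by simp [h] at hz
    refine ⟨∑ k, (1 - ‖a k‖ ^ 2) * ∏ j ∈ Finset.univ.erase k, ‖z - a j‖ ^ 2, ?_, ?_⟩
    · have : Nonempty (Fin n) := ⟨⟨0, hn⟩⟩
      refine Finset.sum_pos (fun k _ => mul_pos ?_ (Finset.prod_pos fun j _ => ?_))
        Finset.univ_nonempty
      · nlinarith [ha k, norm_nonneg (a k)]
      · have : z - a j ≠ 0 := fun h => by
          have := ha j
          rw [← sub_eq_zero.1 h, hz] at this
          exact lt_irrefl _ this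
        positivity
    · rw [eval_critPoly, Complex.ofReal_sum, Finset.sum_mul]
      refine Finset.sum_congr rfl fun k _ => ?_
      have hcard : (Finset.univ.erase k).card = n - 1 := by simp
      rw [← hcard, ← Finset.prod_const, Complex.ofReal_mul, Complex.ofReal_prod, mul_assoc,
        ← Finset.prod_mul_distrib]
      congr 1
      · rw [← Complex.normSq_eq_norm_sq, Complex.ofReal_sub, ← Complex.mul_conj]
        simp [mul_comm]
      · refine Finset.prod_congr rfl fun j _ => ?_
        rw [← Complex.normSq_eq_norm_sq, ← Complex.mul_conj, map_sub, ← Complex.inv_eq_conj hz]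
        field_simp
  refine ⟨degree_critPoly_lt hn, fun z hz h => ?_, fun z hz => ?_⟩
  · obtain ⟨r, hr, h1⟩ := key z hz
    have hz0 : z ≠ 0 := fun h => by simp [h] at hz
    rw [h] at h1
    exact mul_ne_zero (Complex.ofReal_ne_zero.2 hr.ne') (pow_ne_zero _ hz0) h1.symm
  · obtain ⟨r, hr, h1⟩ := key z hz
    rw [h1, norm_mul, norm_pow, hz, one_pow, mul_one, Complex.norm_real,
      Real.norm_of_nonneg hr.le]

theorem eval_derivative_nodal {s : Finset (Fin n)} {w : Fin n → ℂ} {x : ℂ}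
    (h : ∀ k ∈ s, x ≠ w k) :
    (derivative (Lagrange.nodal s w)).eval x =
      (Lagrange.nodal s w).eval x * ∑ k ∈ s, 1 / (x - w k) := by
  rw [Lagrange.derivative_nodal, eval_finsetSum, Finset.mul_sum]
  refine Finset.sum_congr rfl fun k hk => ?_
  rw [Lagrange.nodal_eq_mul_nodal_erase hk]
  have := sub_ne_zero.2 (h k hk)
  simp only [eval_mul, eval_sub, eval_X, eval_C]
  field_simp

/-- The level sets of `B` are equilibria: `q = P - λ D` is a multiple `κ ∏ (X - w_j)`, and
`N = q' D - q D'` gives `N'(w_j) / N(w_j) = q''(w_j) / q'(w_j)`. -/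
theorem isEquilibrium_of_blaschke_eq {w : Fin n → ℂ} (hw : Function.Injective w) {lam : ℂ}
    (hD : ∀ j, (blaschkeDen a).eval (w j) ≠ 0) (h : ∀ j, blaschke a (w j) = lam) :
    IsEquilibrium (critPoly a) w := by
  set q := blaschkeNum a - C lam * blaschkeDen a with hq
  have hq0 : ∀ j, q.eval (w j) = 0 := fun j => by
    have := h j
    rw [blaschke_eq_div, div_eq_iff (hD j)] at this
    simp [hq, this]
  have hdegN : (blaschkeNum a).natDegree ≤ n := by
    refine (natDegree_prod_le _ _).trans ((Finset.sum_le_card_nsmul _ _ 1 fun k _ => ?_).trans ?_)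
    · compute_degree
    · simp
  have hdegD : (blaschkeDen a).natDegree ≤ n := by
    refine (natDegree_prod_le _ _).trans ((Finset.sum_le_card_nsmul _ _ 1 fun k _ => ?_).trans ?_)
    · compute_degree
    · simp
  have hdeg : q.natDegree ≤ n :=
    (natDegree_sub_le _ _).trans (max_le hdegN ((natDegree_C_mul_le _ _).trans hdegD))
  have hqn : q = C (q.coeff n) * Lagrange.nodal Finset.univ w := by
    refine sub_eq_zero.1 (eq_zero_of_degree_lt_of_eval_index_eq_zero
      Finset.univ hw.injOn ?_ fun j hj => ?_)
    · rw [Finset.card_univ, Fintype.card_fin, degree_lt_iff_coeff_zero]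
      intro m hm
      have hnd : (Lagrange.nodal Finset.univ w).natDegree = n := by simp
      rcases hm.eq_or_lt with rfl | hm
      · have hmon : (Lagrange.nodal Finset.univ w).Monic := Lagrange.nodal_monic
        have := hmon.coeff_natDegree
        rw [hnd] at this
        rw [coeff_sub, coeff_C_mul, this]; simp
      · rw [coeff_sub, coeff_C_mul, coeff_eq_zero_of_natDegree_lt (hdeg.trans_lt hm),
          coeff_eq_zero_of_natDegree_lt (hnd.le.trans_lt hm)]
        simp
    · rw [eval_sub, hq0, eval_mul, Lagrange.eval_nodal_at_node hj]; simp
  have hN : critPoly a = derivative q * blaschkeDen a - q * derivative (blaschkeDen a) := by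
    rw [critPoly_eq_wronskian, hq]
    simp only [derivative_sub, derivative_mul, derivative_C]
    ring
  intro j
  set r := Lagrange.nodal (Finset.univ.erase j) w
  have hr : (derivative r).eval (w j) =
      r.eval (w j) * ∑ k ∈ Finset.univ.erase j, 1 / (w j - w k) :=
    eval_derivative_nodal fun k hk e => Finset.ne_of_mem_erase hk (hw e).symm
  have hqr : q = C (q.coeff n) * ((X - C (w j)) * r) := by
    conv_lhs => rw [hqn, Lagrange.nodal_eq_mul_nodal_erase (Finset.mem_univ j)]
  generalize q.coeff n = κ at hqr
  rw [hN, hqr]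
  simp only [derivative_sub, derivative_mul, derivative_C, derivative_X, eval_sub, eval_mul,
    eval_add, eval_C, eval_X, derivative_add, eval_zero, eval_one, derivative_one, derivative_zero]
  rw [hr]
  ring

theorem analyticOrderAt_polynomial {p : ℂ[X]} (hp : p ≠ 0) (z : ℂ) :
    analyticOrderAt (fun x => p.eval x) z = (p.rootMultiplicity z : ℕ) := by
  have han : ∀ q : ℂ[X], AnalyticAt ℂ (fun x => q.eval x) z := fun q =>
    q.differentiable.analyticAt z
  obtain ⟨q, hq, hdvd⟩ := exists_eq_pow_rootMultiplicity_mul_and_not_dvd p hp z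
  rw [(han p).analyticOrderAt_eq_natCast]
  refine ⟨fun x => q.eval x, han q, fun h => hdvd (dvd_iff_isRoot.2 h),
    Filter.Eventually.of_forall fun x => ?_⟩
  conv_lhs => rw [hq]
  simp

theorem analyticOrderAt_deriv_blaschke (h0 : critPoly a ≠ 0) {z : ℂ}
    (hz : (blaschkeDen a).eval z ≠ 0) :
    analyticOrderAt (deriv (blaschke a)) z = ((critPoly a).rootMultiplicity z : ℕ) := by
  have han : ∀ q : ℂ[X], AnalyticAt ℂ (fun x => q.eval x) z := fun q =>
    q.differentiable.analyticAt z
  have hinv : AnalyticAt ℂ (fun x => ((blaschkeDen a).eval x ^ 2)⁻¹) z :=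
    ((han _).pow 2).inv (pow_ne_zero _ hz)
  have hev : deriv (blaschke a) =ᶠ[nhds z]
      (fun x => (critPoly a).eval x) * fun x => ((blaschkeDen a).eval x ^ 2)⁻¹ := by
    filter_upwards [(blaschkeDen a).continuous.continuousAt.eventually_ne hz] with x hx
    rw [(hasDerivAt_blaschke hx).deriv, Pi.mul_apply, div_eq_mul_inv]
  rw [analyticOrderAt_congr hev, analyticOrderAt_mul (han _) hinv,
    analyticOrderAt_polynomial h0, hinv.analyticOrderAt_eq_zero.2 (inv_ne_zero (pow_ne_zero _ hz)),
    add_zero]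

/-- The roots of a polynomial that is self-reciprocal of exponent `m` are permuted by reflection in
the unit circle: reflecting the factorization of `p` gives `X ^ (m - deg p) ∏ (1 - conj r X)` up to a
constant. -/
theorem roots_map_circleReflection {p : ℂ[X]} {m : ℕ} (h0 : p.eval 0 ≠ 0)
    (hp : ∀ z : ℂ, z ≠ 0 → p.eval z = z ^ m * conj (p.eval (circleReflection z)))
    (hm : p.natDegree ≤ m) :
    p.roots.map circleReflection = p.roots ∧ Multiset.card p.roots = m := by
  have hp0 : p ≠ 0 := fun h => h0 (by simp [h])
  have hs := IsAlgClosed.splits p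
  have hcard := hs.natDegree_eq_card_roots
  have hroot0 : ∀ r ∈ p.roots, r ≠ 0 := fun r hr h => by
    have := isRoot_of_mem_roots hr
    rw [h] at this
    exact h0 this
  have hev : p = X ^ (m - p.natDegree) * (C (conj p.leadingCoeff) *
      (p.roots.map fun r => 1 - C (conj r) * X).prod) := by
    refine mul_left_cancel₀ X_ne_zero (Polynomial.funext fun z => ?_)
    by_cases hz : z = 0
    · simp [hz]
    · rw [eval_mul, eval_mul]
      congr 1
      rw [hp z hz, hs.eval_eq_prod_roots]
      have e : z ^ m = z ^ (m - p.natDegree) * z ^ (Multiset.card p.roots) := by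
        rw [← pow_add, ← hcard, Nat.sub_add_cancel hm]
      rw [e, eval_mul, eval_pow, eval_X, mul_assoc]
      congr 1
      rw [eval_mul, eval_C, map_mul, mul_left_comm]
      congr 1
      generalize p.roots = s
      induction s using Multiset.induction_on with
      | empty => simp
      | cons r s ih =>
        simp only [Multiset.map_cons, Multiset.prod_cons, Multiset.card_cons, map_mul, eval_mul]
        rw [← ih, pow_succ]
        simp only [circleReflection, map_sub, map_div₀, map_one, Complex.conj_conj,
          eval_sub, eval_one, eval_mul, eval_C, eval_X]
        field_simp
  have hdeg : p.natDegree = m := by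
    by_contra hne
    apply h0
    rw [hev]
    have : m - p.natDegree ≠ 0 := by omega
    simp [this]
  refine ⟨?_, by rw [← hcard, hdeg]⟩
  have hfac : ∃ c : ℂ, c ≠ 0 ∧
      p = C c * ((p.roots.map circleReflection).map fun r => X - C r).prod := by
    have hgen : ∀ s : Multiset ℂ, (∀ r ∈ s, r ≠ 0) → ∃ c : ℂ,
        (s.map fun r => 1 - C (conj r) * X).prod =
          C c * ((s.map circleReflection).map fun r => X - C r).prod := by
      intro s
      induction s using Multiset.induction_on with
      | empty => exact fun _ => ⟨1, by simp⟩
      | cons r s ih =>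
        intro h
        obtain ⟨c, hc⟩ := ih fun x hx => h x (Multiset.mem_cons_of_mem hx)
        refine ⟨-conj r * c, ?_⟩
        have hr : conj r ≠ 0 := by simpa using h r (Multiset.mem_cons_self r s)
        have e : (1 : ℂ[X]) = C (conj r) * C (circleReflection r) := by
          rw [← C_mul, circleReflection, mul_one_div_cancel hr, C_1]
        simp only [Multiset.map_cons, Multiset.prod_cons, hc, C_mul, C_neg]
        linear_combination (C c * (Multiset.map (fun r => X - C r)
          (Multiset.map circleReflection s)).prod) * e
    obtain ⟨c, hc⟩ := hgen p.roots hroot0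
    rw [hdeg, Nat.sub_self, pow_zero, one_mul, hc, ← mul_assoc, ← C_mul] at hev
    refine ⟨_, fun h => hp0 ?_, hev⟩
    rw [hev, h, C_0, zero_mul]
  obtain ⟨c, hc, he⟩ := hfac
  have := congrArg roots he
  rw [roots_C_mul _ hc, roots_multiset_prod_X_sub_C] at this
  exact this.symm

theorem norm_circleReflection (z : ℂ) : ‖circleReflection z‖ = ‖z‖⁻¹ := by
  simp [circleReflection]

/-- The roots of `critPoly a` are `n - 1` points of the unit disk and their reflections. -/
theorem roots_critPoly_eq (hn : 0 < n) (ha : ∀ k, ‖a k‖ < 1) (hB : deriv (blaschke a) 0 ≠ 0) :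
    (critPoly a).roots = (critPoly a).roots.filter (‖·‖ < 1) +
        ((critPoly a).roots.filter (‖·‖ < 1)).map circleReflection ∧
      Multiset.card ((critPoly a).roots.filter (‖·‖ < 1)) = n - 1 := by
  have h0 := eval_critPoly_zero_ne_zero ha hB
  obtain ⟨hmap, hcard⟩ := roots_map_circleReflection h0
    (fun z hz => eval_critPoly_reflect a hz) natDegree_critPoly_le
  have hout : (critPoly a).roots.filter (¬ ‖·‖ < 1) =
      ((critPoly a).roots.filter (‖·‖ < 1)).map circleReflection := by
    conv_lhs => rw [← hmap]
    rw [Multiset.filter_map]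
    congr 1
    refine Multiset.filter_congr fun r hr => ?_
    have hr0 : r ≠ 0 := fun h => by
      have := isRoot_of_mem_roots hr
      rw [h] at this
      exact h0 this
    have hr1 : ‖r‖ ≠ 1 := fun h =>
      (isCirclePositive_critPoly hn ha).eval_ne_zero r h (isRoot_of_mem_roots hr)
    have hpos : 0 < ‖r‖ := norm_pos_iff.2 hr0
    simp only [Function.comp_apply, norm_circleReflection, not_lt, one_le_inv₀ hpos]
    exact ⟨fun h => lt_of_le_of_ne h hr1, le_of_lt⟩
  have hsum := Multiset.filter_add_not (fun z : ℂ => ‖z‖ < 1) (critPoly a).roots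
  rw [hout] at hsum
  refine ⟨hsum.symm, ?_⟩
  have := congrArg Multiset.card hsum
  rw [Multiset.card_add, Multiset.card_map, hcard] at this
  omega

theorem exists_isCriticalList (hn : 0 < n) (ha : ∀ k, ‖a k‖ < 1)
    (hB : deriv (blaschke a) 0 ≠ 0) : ∃ ζ : Fin (n - 1) → ℂ, IsCriticalList a ζ := by
  obtain ⟨hroots, hcard⟩ := roots_critPoly_eq hn ha hB
  have h0 := eval_critPoly_zero_ne_zero ha hB
  set s := (critPoly a).roots.filter (‖·‖ < 1) with hs
  have hlen : s.toList.length = n - 1 := by rw [Multiset.length_toList, hcard]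
  obtain ⟨ζ, hζ⟩ : ∃ ζ : Fin (n - 1) → ℂ, Finset.univ.val.map ζ = s := by
    rw [← hlen]
    refine ⟨s.toList.get, ?_⟩
    rw [Fin.univ_val_map, List.ofFn_get, Multiset.coe_toList]
  have hmem : ∀ k, ζ k ∈ s := fun k => hζ ▸ Multiset.mem_map_of_mem ζ (Finset.mem_univ_val k)
  refine ⟨ζ, fun k => (Multiset.mem_filter.1 (hmem k)).2, fun k h => ?_, fun z hz => ?_⟩
  · have := isRoot_of_mem_roots (Multiset.mem_filter.1 (hmem k)).1
    rw [h] at this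
    exact h0 this
  · rw [analyticOrderAt_deriv_blaschke (fun h => h0 (by simp [h]))
      ((eval_blaschkeDen_ne_zero_iff a z).2 hz), ← count_roots, hroots, ← hζ, Multiset.map_map,
      Multiset.count_add, Multiset.count_map, Multiset.count_map]
    simp only [Function.comp_apply, eq_comm (a := z)]
    rfl

/-- Critical lists only refer to points that are not poles of `B`, but these include the unit disk,
and the roots there determine the others by reflection. -/
theorem IsCriticalList.eval_critPoly {ζ : Fin (n - 1) → ℂ} (hζ : IsCriticalList a ζ)
    (hn : 0 < n) (ha : ∀ k, ‖a k‖ < 1) (hB : deriv (blaschke a) 0 ≠ 0) :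
    ∃ c : ℂ, c ≠ 0 ∧ ∀ z, (critPoly a).eval z =
      c * ∏ k, ((z - ζ k) * (z - circleReflection (ζ k))) := by
  obtain ⟨hroots, -⟩ := roots_critPoly_eq hn ha hB
  have h0 := eval_critPoly_zero_ne_zero ha hB
  have hN0 : critPoly a ≠ 0 := fun h => h0 (by simp [h])
  have hs : (critPoly a).roots.filter (‖·‖ < 1) = Finset.univ.val.map ζ := by
    ext z
    by_cases hz : ‖z‖ < 1
    · have hD := eval_blaschkeDen_ne_zero ha hz.le
      have h1 := hζ.order_eq z ((eval_blaschkeDen_ne_zero_iff a z).1 hD)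
      rw [analyticOrderAt_deriv_blaschke hN0 hD] at h1
      have h2 : ({k | circleReflection (ζ k) = z} : Finset (Fin (n - 1))) = ∅ := by
        refine Finset.filter_eq_empty_iff.2 fun k _ h => ?_
        rw [← h, norm_circleReflection] at hz
        have := (one_lt_inv₀ (norm_pos_iff.2 (hζ.ne_zero k))).2 (hζ.norm_lt_one k)
        linarith
      rw [h2, Finset.card_empty, add_zero] at h1
      rw [Multiset.count_filter_of_pos (p := fun z : ℂ => ‖z‖ < 1) hz, count_roots,
        ENat.natCast_inj.1 h1, Multiset.count_map]
      simp only [eq_comm (a := z)]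
      rfl
    · rw [Multiset.count_filter_of_neg (p := fun z : ℂ => ‖z‖ < 1) hz, eq_comm,
        Multiset.count_eq_zero]
      intro h
      obtain ⟨k, -, rfl⟩ := Multiset.mem_map.1 h
      exact hz (hζ.norm_lt_one k)
  rw [hs] at hroots
  refine ⟨(critPoly a).leadingCoeff, leadingCoeff_ne_zero.2 hN0, fun z => ?_⟩
  rw [(IsAlgClosed.splits (critPoly a)).eval_eq_prod_roots z, hroots, Finset.prod_mul_distrib]
  simp only [Multiset.map_add, Multiset.prod_add, Multiset.map_map]
  rfl

end Polynomials

section Angle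

/-! ### The lift of the argument of a Blaschke product -/

variable {n : ℕ} {a : Fin n → ℂ}

/-- The lift of the argument of `B(e^{iτ})` to the real line with value `α` at `0`. On the circle,
`(z - b) / (1 - conj b z) = z u / conj u` with `u = 1 - b / z` in the right half-plane, so that the
principal argument of `u` is smooth. -/
noncomputable def blaschkeAngle (a : Fin n → ℂ) (α τ : ℝ) : ℝ :=
  α + ∑ k, (τ + 2 * (Complex.arg (1 - a k * Complex.exp (-(τ * Complex.I))) -
    Complex.arg (1 - a k)))

theorem norm_mul_exp_neg_lt_one {b : ℂ} (hb : ‖b‖ < 1) (τ : ℝ) :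
    ‖b * Complex.exp (-(τ * Complex.I))‖ < 1 := by
  have : -((τ : ℂ) * Complex.I) = ((-τ : ℝ) : ℂ) * Complex.I := by push_cast; ring
  rwa [norm_mul, this, Complex.norm_exp_ofReal_mul_I, mul_one]

theorem one_sub_mem_slitPlane {u : ℂ} (hu : ‖u‖ < 1) : 1 - u ∈ Complex.slitPlane := by
  left
  have := (Complex.re_le_norm u).trans_lt hu
  simpa using this

theorem hasDerivAt_arg_one_sub {b : ℂ} (hb : ‖b‖ < 1) (τ : ℝ) :
    HasDerivAt (fun τ : ℝ => Complex.arg (1 - b * Complex.exp (-(τ * Complex.I))))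
      ((b * Complex.exp (-(τ * Complex.I)) / (1 - b * Complex.exp (-(τ * Complex.I)))).re) τ := by
  have hu := norm_mul_exp_neg_lt_one hb τ
  have h1 : HasDerivAt (fun τ : ℝ => 1 - b * Complex.exp (-(τ * Complex.I)))
      (Complex.I * (b * Complex.exp (-(τ * Complex.I)))) τ := by
    have h :=
      ((((hasDerivAt_id τ).ofReal_comp.mul_const Complex.I).neg).cexp.const_mul b).const_sub 1
    refine h.congr_deriv ?_
    simp
    ring
  have h2 := h1.clog_real (one_sub_mem_slitPlane hu)
  have h3 := (Complex.imCLM.hasFDerivAt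
    (x := Complex.log (1 - b * Complex.exp (-(τ * Complex.I))))).comp_hasDerivAt τ h2
  have e : (fun τ : ℝ => Complex.arg (1 - b * Complex.exp (-(τ * Complex.I)))) =
      Complex.imCLM ∘ fun t : ℝ => Complex.log (1 - b * Complex.exp (-(t * Complex.I))) :=
    funext fun t => (Complex.log_im _).symm
  rw [e]
  refine h3.congr_deriv ?_
  rw [mul_div_assoc]
  simp

theorem re_one_add_two_mul_div_pos {u : ℂ} (hu : ‖u‖ < 1) : 0 < 1 + 2 * (u / (1 - u)).re := by
  have h0 : 1 - u ≠ 0 := Complex.slitPlane_ne_zero (one_sub_mem_slitPlane hu)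
  have hs : 0 < Complex.normSq (1 - u) := Complex.normSq_pos.2 h0
  have hu2 : Complex.normSq u < 1 := by
    rw [Complex.normSq_eq_norm_sq]; nlinarith [norm_nonneg u]
  have e : 1 + 2 * (u / (1 - u)).re = (1 - Complex.normSq u) / Complex.normSq (1 - u) := by
    rw [Complex.div_re, eq_div_iff hs.ne']
    field_simp
    simp only [Complex.normSq_apply, Complex.sub_re, Complex.sub_im, Complex.one_re,
      Complex.one_im]
    ring
  rw [e]
  exact div_pos (by linarith) hs

theorem hasDerivAt_blaschkeAngle (ha : ∀ k, ‖a k‖ < 1) (α τ : ℝ) :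
    HasDerivAt (blaschkeAngle a α) (∑ k, (1 + 2 * (a k * Complex.exp (-(τ * Complex.I)) /
      (1 - a k * Complex.exp (-(τ * Complex.I)))).re)) τ := by
  refine HasDerivAt.const_add α (HasDerivAt.fun_sum fun k _ => ?_)
  exact (hasDerivAt_id τ).add (((hasDerivAt_arg_one_sub (ha k) τ).sub_const _).const_mul 2)

theorem contDiff_blaschkeAngle (ha : ∀ k, ‖a k‖ < 1) (α : ℝ) :
    ContDiff ℝ 1 (blaschkeAngle a α) := by
  rw [contDiff_one_iff_deriv]
  refine ⟨fun τ => (hasDerivAt_blaschkeAngle ha α τ).differentiableAt, ?_⟩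
  rw [funext fun τ => (hasDerivAt_blaschkeAngle ha α τ).deriv]
  refine continuous_finsetSum _ fun k _ => continuous_const.add (continuous_const.mul
    (Complex.continuous_re.comp (Continuous.div (by fun_prop) (by fun_prop) fun τ => ?_)))
  exact Complex.slitPlane_ne_zero (one_sub_mem_slitPlane (norm_mul_exp_neg_lt_one (ha k) τ))

theorem exp_two_mul_arg {u : ℂ} (hu : u ≠ 0) :
    Complex.exp (2 * (Complex.arg u : ℂ) * Complex.I) = u / conj u := by
  have h := Complex.norm_mul_exp_arg_mul_I u
  have hn : (‖u‖ : ℂ) ≠ 0 := by exact_mod_cast norm_ne_zero_iff.2 hu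
  have hc : conj u ≠ 0 := by simpa using hu
  have h2 := Complex.mul_conj' u
  rw [mul_assoc, two_mul, Complex.exp_add, eq_div_iff hc]
  have h3 : Complex.exp (u.arg * Complex.I) = u / ‖u‖ := by
    rw [eq_div_iff hn, mul_comm, h]
  rw [h3]
  field_simp
  rw [← h2]

theorem exp_blaschkeAngle (ha : ∀ k, ‖a k‖ < 1) {α : ℝ}
    (hα : blaschke a 1 = Complex.exp (α * Complex.I)) (τ : ℝ) :
    Complex.exp (blaschkeAngle a α τ * Complex.I) =
      blaschke a (Complex.exp (τ * Complex.I)) := by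
  have key : ∀ (k : Fin n) (t : ℝ), Complex.exp ((t + 2 * (Complex.arg
      (1 - a k * Complex.exp (-(t * Complex.I))) : ℂ)) * Complex.I) =
      (Complex.exp (t * Complex.I) - a k) / (1 - conj (a k) * Complex.exp (t * Complex.I)) := by
    intro k t
    have hu0 := Complex.slitPlane_ne_zero
      (one_sub_mem_slitPlane (norm_mul_exp_neg_lt_one (ha k) t))
    have hc : conj (Complex.exp (-(t * Complex.I))) = Complex.exp (t * Complex.I) := by
      rw [← Complex.exp_conj]; simp
    rw [add_mul, Complex.exp_add, exp_two_mul_arg hu0, map_sub, map_mul, map_one, hc,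
      Complex.exp_neg, ← mul_div_assoc]
    congr 1
    have := Complex.exp_ne_zero (t * Complex.I)
    field_simp
  have hden : ∀ k, Complex.exp ((2 * (Complex.arg (1 - a k) : ℂ)) * Complex.I) =
      (1 - a k) / (1 - conj (a k)) := by
    intro k
    simpa using key k 0
  have h1 : ∏ k, Complex.exp ((2 * (Complex.arg (1 - a k) : ℂ)) * Complex.I) =
      Complex.exp (α * Complex.I) := by
    rw [← hα, Finset.prod_congr rfl fun k _ => hden k]
    simp [blaschke]
  rw [blaschkeAngle]
  push_cast
  rw [add_mul, Complex.exp_add, Finset.sum_mul, Complex.exp_sum, blaschke,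
    Finset.prod_congr rfl fun k _ => (key k τ).symm, ← h1, ← Finset.prod_mul_distrib]
  refine Finset.prod_congr rfl fun k _ => ?_
  rw [← Complex.exp_add]
  congr 1
  ring

theorem blaschkeAngle_zero (a : Fin n → ℂ) (α : ℝ) : blaschkeAngle a α 0 = α := by
  simp [blaschkeAngle]

theorem blaschkeAngle_add_two_pi (a : Fin n → ℂ) (α τ : ℝ) :
    blaschkeAngle a α (τ + 2 * Real.pi) = blaschkeAngle a α τ + 2 * Real.pi * n := by
  have h : Complex.exp (-(((τ + 2 * Real.pi : ℝ) : ℂ) * Complex.I)) =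
      Complex.exp (-(τ * Complex.I)) := by
    rw [Complex.exp_eq_exp_iff_exists_int]
    exact ⟨-1, by push_cast; ring⟩
  simp only [blaschkeAngle, h, Finset.sum_add_distrib, Finset.sum_const, Finset.card_univ,
    Fintype.card_fin, nsmul_eq_mul]
  ring

theorem strictMono_blaschkeAngle (hn : 0 < n) (ha : ∀ k, ‖a k‖ < 1) (α : ℝ) :
    StrictMono (blaschkeAngle a α) := by
  have : Nonempty (Fin n) := ⟨⟨0, hn⟩⟩
  refine strictMono_of_hasDerivAt_pos (fun τ => hasDerivAt_blaschkeAngle ha α τ) fun τ =>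
    Finset.sum_pos (fun k _ => ?_) Finset.univ_nonempty
  exact re_one_add_two_mul_div_pos (norm_mul_exp_neg_lt_one (ha k) τ)

theorem surjective_blaschkeAngle (hn : 0 < n) (ha : ∀ k, ‖a k‖ < 1) (α : ℝ) :
    Function.Surjective (blaschkeAngle a α) := by
  have hn' : (0 : ℝ) < n := by exact_mod_cast hn
  have hcard : ∀ c : ℝ, ∑ _k : Fin n, c = n * c := fun c => by simp
  have hb : ∀ (z w : ℂ), |z.arg - w.arg| ≤ 2 * Real.pi := fun z w => by
    have := Complex.abs_arg_le_pi z
    have := Complex.abs_arg_le_pi w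
    rw [abs_le] at *
    constructor <;> linarith
  refine (contDiff_blaschkeAngle ha α).continuous.surjective ?_ ?_
  · refine Filter.tendsto_atTop_mono (f := fun τ => (α - n * (4 * Real.pi)) + n * τ) (fun τ => ?_)
      (Filter.tendsto_atTop_add_const_left _ _ (Filter.tendsto_id.const_mul_atTop hn'))
    have : ∑ _k : Fin n, (τ - 4 * Real.pi) ≤ ∑ k, (τ + 2 * (Complex.arg (1 - a k *
        Complex.exp (-(τ * Complex.I))) - Complex.arg (1 - a k))) :=
      Finset.sum_le_sum fun k _ => by
        have := (abs_le.1 (hb (1 - a k * Complex.exp (-(τ * Complex.I))) (1 - a k))).1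
        linarith
    rw [hcard] at this
    rw [blaschkeAngle]
    linarith
  · refine Filter.tendsto_atBot_mono (f := fun τ => (α + n * (4 * Real.pi)) + n * τ) (fun τ => ?_)
      (Filter.tendsto_atBot_add_const_left _ _ (Filter.tendsto_id.const_mul_atBot hn'))
    have : ∑ k, (τ + 2 * (Complex.arg (1 - a k *
        Complex.exp (-(τ * Complex.I))) - Complex.arg (1 - a k))) ≤
        ∑ _k : Fin n, (τ + 4 * Real.pi) :=
      Finset.sum_le_sum fun k _ => by
        have := (abs_le.1 (hb (1 - a k * Complex.exp (-(τ * Complex.I))) (1 - a k))).2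
        linarith
    rw [hcard] at this
    rw [blaschkeAngle]
    linarith

/-- `n` increasing integers that start at `0` and have spread less than `n` are `0, …, n - 1`. -/
theorem eq_coe_of_strictMono {m : Fin n → ℤ} (hm : ∀ j k, j < k → m j < m k)
    (hlt : ∀ j k, m k < m j + n) (h0 : ∀ j : Fin n, (j : ℕ) = 0 → m j = 0) (j : Fin n) :
    m j = j := by
  have key : ∀ (d : ℕ) (i k : Fin n), (k : ℕ) = i + d → m i + d ≤ m k := by
    intro d
    induction d with
    | zero => intro i k h; rw [Fin.ext (h.trans (add_zero _)) (a := k) (b := i)]; simp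
    | succ d ih =>
      intro i k h
      have h1 := ih i ⟨i + d, by omega⟩ rfl
      have h2 := hm ⟨i + d, by omega⟩ k (Fin.lt_def.2 (by simp; omega))
      push_cast
      linarith
  have h1 := key j ⟨0, j.pos⟩ j (by simp)
  have h2 := key (n - 1 - j) j ⟨n - 1, by omega⟩ (by simp; omega)
  have h3 := hlt ⟨0, j.pos⟩ ⟨n - 1, by omega⟩
  rw [h0 ⟨0, j.pos⟩ rfl] at h1 h3
  omega

/-- If `B` takes the same value at all `e^{iτ_j}`, the lifted arguments are consecutive translates by
`2π`. -/
theorem blaschkeAngle_eq_of_blaschke_eq (hn : 0 < n) (ha : ∀ k, ‖a k‖ < 1) {α : ℝ}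
    (hα : blaschke a 1 = Complex.exp (α * Complex.I)) {τ : EuclideanSpace ℝ (Fin n)}
    (hτ : τ ∈ orderedAngles n)
    (h : ∀ j, blaschke a (Complex.exp (τ j * Complex.I)) =
      blaschke a (Complex.exp (τ ⟨0, hn⟩ * Complex.I))) (j : Fin n) :
    blaschkeAngle a α (τ j) = blaschkeAngle a α (τ ⟨0, hn⟩) + 2 * Real.pi * (j : ℕ) := by
  have hpi := Real.pi_pos
  have hex : ∀ j, ∃ m : ℤ, blaschkeAngle a α (τ j) =
      blaschkeAngle a α (τ ⟨0, hn⟩) + 2 * Real.pi * m := by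
    intro j
    have h1 := h j
    rw [← exp_blaschkeAngle ha hα, ← exp_blaschkeAngle ha hα,
      Complex.exp_eq_exp_iff_exists_int] at h1
    obtain ⟨m, hm⟩ := h1
    refine ⟨m, ?_⟩
    have h2 : ((blaschkeAngle a α (τ j) : ℝ) : ℂ) * Complex.I =
        ((blaschkeAngle a α (τ ⟨0, hn⟩) + 2 * Real.pi * m : ℝ) : ℂ) * Complex.I := by
      rw [hm]; push_cast; ring
    exact Complex.ofReal_injective (mul_right_cancel₀ Complex.I_ne_zero h2)
  choose m hm using hex
  have hmono := strictMono_blaschkeAngle hn ha α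
  have hmj : m j = j := by
    refine eq_coe_of_strictMono (fun i k hik => ?_) (fun i k => ?_) (fun i hi => ?_) j
    · have h1 := hmono (hτ.1 i k hik)
      rw [hm i, hm k] at h1
      have h2 : (m i : ℝ) < m k := by
        have : 2 * Real.pi * (m i : ℝ) < 2 * Real.pi * m k := by linarith
        exact lt_of_mul_lt_mul_left this (by positivity)
      exact_mod_cast h2
    · have h1 := hmono (hτ.2 i k)
      rw [blaschkeAngle_add_two_pi, hm i, hm k] at h1
      have h2 : (m k : ℝ) < m i + n := by
        have : 2 * Real.pi * (m k : ℝ) < 2 * Real.pi * (m i + n) := by linarith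
        exact lt_of_mul_lt_mul_left this (by positivity)
      exact_mod_cast h2
    · have hi' : i = ⟨0, hn⟩ := Fin.ext hi
      have h1 := hm i
      rw [hi'] at h1 ⊢
      have h2 : 2 * Real.pi * (m ⟨0, hn⟩ : ℝ) = 0 := by linarith
      have h3 := (mul_eq_zero.1 h2).resolve_left (by positivity)
      exact_mod_cast h3
  rw [hm j, hmj]
  simp

/-- A solution path is unique: its lifted arguments differ from `δ` by multiples of `2π`, which are
independent of `δ` by continuity. -/
theorem IsSolutionPath.blaschkeAngle_eq {α : ℝ} {T : ℝ → EuclideanSpace ℝ (Fin n)}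
    (hT : IsSolutionPath a α T) (hn : 0 < n) (ha : ∀ k, ‖a k‖ < 1)
    (hα : blaschke a 1 = Complex.exp (α * Complex.I)) (δ : ℝ) (j : Fin n) :
    blaschkeAngle a α (T δ j) = δ + 2 * Real.pi * (j : ℕ) := by
  rw [blaschkeAngle_eq_of_blaschke_eq hn ha hα (hT.mem_orderedAngles δ)
    (fun j => by rw [hT.solution, hT.solution])]
  congr 1
  have hex : ∀ δ, ∃ m : ℤ, blaschkeAngle a α (T δ ⟨0, hn⟩) - δ = 2 * Real.pi * m := by
    intro δ
    have h1 := hT.solution δ ⟨0, hn⟩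
    rw [← exp_blaschkeAngle ha hα, Complex.exp_eq_exp_iff_exists_int] at h1
    obtain ⟨m, hm⟩ := h1
    refine ⟨m, ?_⟩
    have h2 : ((blaschkeAngle a α (T δ ⟨0, hn⟩) - δ : ℝ) : ℂ) * Complex.I =
        ((2 * Real.pi * m : ℝ) : ℂ) * Complex.I := by
      rw [Complex.ofReal_sub, sub_mul, hm]; push_cast; ring
    exact Complex.ofReal_injective (mul_right_cancel₀ Complex.I_ne_zero h2)
  choose m hm using hex
  have hpi := Real.two_pi_pos
  have hcont : Continuous m := by
    rw [Int.isClosedEmbedding_coe_real.isInducing.continuous_iff]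
    have e : (fun k : ℤ => (k : ℝ)) ∘ m =
        fun δ => (blaschkeAngle a α (T δ ⟨0, hn⟩) - δ) / (2 * Real.pi) := by
      funext δ
      rw [hm]
      simp [mul_div_cancel_left₀ _ hpi.ne']
    rw [e]
    have h1 : Continuous fun δ => T δ ⟨0, hn⟩ :=
      (EuclideanSpace.proj (𝕜 := ℝ) (⟨0, hn⟩ : Fin n)).continuous.comp hT.contDiff.continuous
    exact (((contDiff_blaschkeAngle ha α).continuous.comp h1).sub continuous_id).div_const _
  have hconst : m δ = m α := PreconnectedSpace.constant inferInstance hcont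
  have h0 := hm α
  rw [hT.first_eq_zero _ rfl, blaschkeAngle_zero, sub_self] at h0
  have := hm δ
  rw [hconst, ← h0] at this
  linarith

theorem exists_isSolutionPath (hn : 0 < n) (ha : ∀ k, ‖a k‖ < 1) {α : ℝ}
    (hα : blaschke a 1 = Complex.exp (α * Complex.I)) :
    ∃ T : ℝ → EuclideanSpace ℝ (Fin n), IsSolutionPath a α T := by
  have hpi := Real.pi_pos
  set φ : ℝ ≃o ℝ := (strictMono_blaschkeAngle hn ha α).orderIsoOfSurjective _
    (surjective_blaschkeAngle hn ha α) with hφ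
  have hφe : ∀ τ, φ τ = blaschkeAngle a α τ := fun τ => rfl
  have hsymm : ContDiff ℝ 1 φ.symm := by
    refine Homeomorph.contDiff_symm_deriv (f := φ.toHomeomorph) (f' := _) (fun τ => ?_)
      (fun τ => hasDerivAt_blaschkeAngle ha α τ) (contDiff_blaschkeAngle ha α)
    have : Nonempty (Fin n) := ⟨⟨0, hn⟩⟩
    exact (Finset.sum_pos (fun k _ => re_one_add_two_mul_div_pos
      (norm_mul_exp_neg_lt_one (ha k) τ)) Finset.univ_nonempty).ne'
  refine ⟨fun δ => WithLp.toLp 2 fun j => φ.symm (δ + 2 * Real.pi * (j : ℕ)), ?_, ?_, ?_, ?_, ?_⟩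
  · rw [contDiff_euclidean]
    exact fun j => hsymm.comp (contDiff_id.add contDiff_const)
  · intro j x y hxy
    exact φ.symm.strictMono (by linarith)
  · refine fun δ => ⟨fun j k hjk => φ.symm.strictMono ?_, fun j k => ?_⟩
    · have : ((j : ℕ) : ℝ) < (k : ℕ) := by exact_mod_cast hjk
      nlinarith
    · change φ.symm _ < φ.symm _ + 2 * Real.pi
      rw [φ.symm_apply_lt, hφe, blaschkeAngle_add_two_pi, ← hφe, φ.apply_symm_apply]
      have : ((k : ℕ) : ℝ) < (j : ℕ) + n := by
        exact_mod_cast (by omega : (k : ℕ) < j + n)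
      nlinarith
  · intro δ j
    change blaschke a (Complex.exp (((φ.symm (δ + 2 * Real.pi * (j : ℕ)) : ℝ) : ℂ) * _)) = _
    rw [← exp_blaschkeAngle ha hα, ← hφe, φ.apply_symm_apply,
      Complex.exp_eq_exp_iff_exists_int]
    exact ⟨j, by push_cast; ring⟩
  · intro j hj
    change φ.symm (α + 2 * Real.pi * (j : ℕ)) = 0
    rw [φ.symm_apply_eq, hφe, blaschkeAngle_zero, hj]
    simp

end Angle

section Energy

/-! ### The energy on the unit circle -/

variable {n : ℕ} {a : Fin n → ℂ} {ζ : Fin (n - 1) → ℂ}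

theorem norm_circlePoints (τ : EuclideanSpace ℝ (Fin n)) (j : Fin n) : ‖circlePoints τ j‖ = 1 :=
  Complex.norm_exp_ofReal_mul_I _

theorem injective_circlePoints {τ : EuclideanSpace ℝ (Fin n)} (hτ : τ ∈ orderedAngles n) :
    Function.Injective (circlePoints τ) := by
  have key : ∀ j k, j < k → circlePoints τ j ≠ circlePoints τ k := by
    intro j k hjk h
    obtain ⟨m, hm⟩ := Complex.exp_eq_exp_iff_exists_int.1 h
    have h2 : ((τ j : ℝ) : ℂ) * Complex.I = ((τ k + 2 * Real.pi * m : ℝ) : ℂ) * Complex.I := by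
      rw [hm]; push_cast; ring
    have h3 : τ j = τ k + 2 * Real.pi * m :=
      Complex.ofReal_injective (mul_right_cancel₀ Complex.I_ne_zero h2)
    have h4 := hτ.1 j k hjk
    have h5 := hτ.2 j k
    have hpi := Real.two_pi_pos
    have h6 : (m : ℝ) < 0 := by
      by_contra hge
      have := mul_nonneg hpi.le (not_lt.1 hge)
      linarith
    have h7 : (-1 : ℝ) < m := by
      by_contra hge
      have := mul_le_mul_of_nonneg_left (not_lt.1 hge) hpi.le
      linarith
    have h8 : m < 0 := by exact_mod_cast h6
    have h9 : -1 < m := by exact_mod_cast h7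
    omega
  intro j k h
  rcases lt_trichotomy j k with hjk | hjk | hjk
  · exact absurd h (key j k hjk)
  · exact hjk
  · exact absurd h.symm (key k j hjk)

theorem energy_eq {N : Polynomial ℂ} (hN : IsCirclePositive n N) {c : ℂ} (hc : c ≠ 0)
    (hfac : ∀ z, N.eval z = c * ∏ k, ((z - ζ k) * (z - circleReflection (ζ k))))
    {w : Fin n → ℂ} (hw1 : ∀ j, ‖w j‖ = 1) :
    energy ζ w = ∑ j, Real.log ‖N.eval (w j)‖ - n * Real.log ‖c‖
      - 2 * ∑ j, ∑ k ∈ Finset.Ioi j, Real.log ‖w j - w k‖ := by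
  rw [energy, Finset.sum_comm]
  congr 1
  have h : ∀ j, ∑ k, Real.log ‖(w j - ζ k) * (w j - circleReflection (ζ k))‖ =
      Real.log ‖N.eval (w j)‖ - Real.log ‖c‖ := by
    intro j
    have h0 := hN.eval_ne_zero _ (hw1 j)
    have h1 := hfac (w j)
    rw [h1] at h0 ⊢
    have h2 := right_ne_zero_of_mul h0
    rw [norm_mul, Real.log_mul (norm_ne_zero_iff.2 hc) (norm_ne_zero_iff.2 h2), norm_prod,
      Real.log_prod fun k _ => norm_ne_zero_iff.2
        (Finset.prod_ne_zero_iff.1 h2 k (Finset.mem_univ k))]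
    ring
  rw [Finset.sum_congr rfl fun j _ => h j, Finset.sum_sub_distrib]
  simp

theorem log_norm_det_vandermonde {w : Fin n → ℂ} (hw : Function.Injective w) :
    Real.log ‖(Matrix.vandermonde w).det‖ =
      ∑ j, ∑ k ∈ Finset.Ioi j, Real.log ‖w j - w k‖ := by
  have hne : ∀ j, ∀ k ∈ Finset.Ioi j, ‖w k - w j‖ ≠ 0 := fun j k hk =>
    norm_ne_zero_iff.2 (sub_ne_zero.2 fun e => (Finset.mem_Ioi.1 hk).ne' (hw e))
  rw [Matrix.det_vandermonde, norm_prod, Real.log_prod]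
  · refine Finset.sum_congr rfl fun j _ => ?_
    rw [norm_prod, Real.log_prod (hne j)]
    exact Finset.sum_congr rfl fun k _ => by rw [norm_sub_rev]
  · intro j _
    rw [norm_prod]
    exact Finset.prod_ne_zero_iff.2 (hne j)

/-- Equilibria minimize the energy. -/
theorem IsEquilibrium.energy_le {N : Polynomial ℂ} {w v : Fin n → ℂ}
    (h : IsEquilibrium N w) (hN : IsCirclePositive n N) {c : ℂ} (hc : c ≠ 0)
    (hfac : ∀ z, N.eval z = c * ∏ k, ((z - ζ k) * (z - circleReflection (ζ k))))
    (hw : Function.Injective w) (hw1 : ∀ j, ‖w j‖ = 1)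
    (hv : Function.Injective v) (hv1 : ∀ j, ‖v j‖ = 1) :
    energy ζ w ≤ energy ζ v ∧
      (energy ζ w = energy ζ v → ∀ i₀, v i₀ = w i₀ → ∀ i, v i ∈ Set.range w) := by
  obtain ⟨hle, heq⟩ := h.norm_det_vandermonde_le hN hw hw1 hv1
  have hpos : ∀ u : Fin n → ℂ, (∀ j, ‖u j‖ = 1) → ∀ j, 0 < ‖N.eval (u j)‖ := fun u hu j =>
    norm_pos_iff.2 (hN.eval_ne_zero _ (hu j))
  have hV : ∀ u : Fin n → ℂ, Function.Injective u → 0 < ‖(Matrix.vandermonde u).det‖ :=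
    fun u hu => norm_pos_iff.2 (Matrix.det_vandermonde_ne_zero_iff.2 hu)
  have hpr : ∀ u : Fin n → ℂ, (∀ j, ‖u j‖ = 1) → 0 < ∏ j, ‖N.eval (u j)‖ := fun u hu =>
    Finset.prod_pos fun j _ => hpos u hu j
  have hlog : ∀ u u' : Fin n → ℂ, (∀ j, ‖u j‖ = 1) → Function.Injective u' →
      Real.log ((∏ j, ‖N.eval (u j)‖) * ‖(Matrix.vandermonde u').det‖ ^ 2) =
        ∑ j, Real.log ‖N.eval (u j)‖ + 2 * ∑ j, ∑ k ∈ Finset.Ioi j, Real.log ‖u' j - u' k‖ := by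
    intro u u' hu hu'
    rw [Real.log_mul (hpr u hu).ne' (pow_ne_zero _ (hV u' hu').ne'), Real.log_pow,
      log_norm_det_vandermonde hu', Real.log_prod fun j _ => (hpos u hu j).ne']
    norm_num
  have h1 := hlog w v hw1 hv
  have h2 := hlog v w hv1 hw
  have p1 : 0 < (∏ j, ‖N.eval (w j)‖) * ‖(Matrix.vandermonde v).det‖ ^ 2 :=
    mul_pos (hpr w hw1) (pow_pos (hV v hv) _)
  have p2 : 0 < (∏ j, ‖N.eval (v j)‖) * ‖(Matrix.vandermonde w).det‖ ^ 2 :=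
    mul_pos (hpr v hv1) (pow_pos (hV w hw) _)
  rw [energy_eq hN hc hfac hw1, energy_eq hN hc hfac hv1]
  refine ⟨?_, fun e => heq (Real.log_injOn_pos p1 p2 ?_)⟩
  · have := Real.log_le_log p1 hle
    linarith
  · linarith

theorem hasDerivAt_log_norm {g : ℝ → ℂ} {g' : ℂ} {t : ℝ} (hg : HasDerivAt g g' t)
    (h0 : g t ≠ 0) : HasDerivAt (fun t => Real.log ‖g t‖) (g' / g t).re t := by
  have h1 := (hg.norm_sq.log (pow_ne_zero 2 (norm_ne_zero_iff.2 h0))).div_const 2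
  have e : (fun t => Real.log ‖g t‖) = fun t => Real.log (‖g t‖ ^ 2) / 2 := by
    funext t
    rw [Real.log_pow]
    push_cast
    ring
  rw [e]
  refine h1.congr_deriv ?_
  rw [Complex.inner, Complex.div_re, ← Complex.normSq_eq_norm_sq]
  have := (Complex.normSq_pos.2 h0).ne'
  simp only [Complex.mul_re, Complex.conj_re, Complex.conj_im]
  field_simp
  ring

theorem hasDerivAt_exp_mul_I (τ : ℝ) :
    HasDerivAt (fun t : ℝ => Complex.exp (t * Complex.I))
      (Complex.I * Complex.exp (τ * Complex.I)) τ := by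
  have h := ((hasDerivAt_id τ).ofReal_comp.mul_const Complex.I).cexp
  refine h.congr_deriv ?_
  simp
  ring

/-- On the unit circle `N` has the argument of `z ^ (n - 1)`, which fixes the radial part `n - 1` of
`z N'(z) / N(z)`. The rest is the derivative of `log |N|` along the circle. -/
theorem hasDerivAt_log_norm_eval {N : Polynomial ℂ} (hN : IsCirclePositive n N) (τ : ℝ) :
    ∃ f' : ℝ, HasDerivAt (fun t : ℝ => Real.log ‖N.eval (Complex.exp (t * Complex.I))‖) f' τ ∧
      Complex.I * Complex.exp (τ * Complex.I) * N.derivative.eval (Complex.exp (τ * Complex.I)) =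
        (f' + ((n - 1 : ℕ) : ℂ) * Complex.I) * N.eval (Complex.exp (τ * Complex.I)) := by
  have hne : ∀ t : ℝ, N.eval (Complex.exp (t * Complex.I)) ≠ 0 := fun t =>
    hN.eval_ne_zero _ (Complex.norm_exp_ofReal_mul_I t)
  have h1 : HasDerivAt (fun t : ℝ => N.eval (Complex.exp (t * Complex.I)))
      (N.derivative.eval (Complex.exp (τ * Complex.I)) *
        (Complex.I * Complex.exp (τ * Complex.I))) τ :=
    (N.hasDerivAt _).comp τ (hasDerivAt_exp_mul_I τ)
  have h2 := hasDerivAt_log_norm h1 (hne τ)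
  refine ⟨_, h2, ?_⟩
  set f' := ((N.derivative.eval (Complex.exp (τ * Complex.I)) *
        (Complex.I * Complex.exp (τ * Complex.I))) / N.eval (Complex.exp (τ * Complex.I))).re
  have h3 : (fun t : ℝ => N.eval (Complex.exp (t * Complex.I))) = fun t : ℝ =>
      Complex.exp (((Real.log ‖N.eval (Complex.exp (t * Complex.I))‖ : ℝ) : ℂ) +
        ((n - 1 : ℕ) : ℂ) * (t * Complex.I)) := by
    funext t
    rw [Complex.exp_add, Complex.exp_nat_mul, ← Complex.ofReal_exp,
      Real.exp_log (norm_pos_iff.2 (hne t))]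
    exact hN.eval_eq _ (Complex.norm_exp_ofReal_mul_I t)
  have h4 := (h2.ofReal_comp.add
    (((hasDerivAt_id τ).ofReal_comp.mul_const Complex.I).const_mul ((n - 1 : ℕ) : ℂ))).cexp
  have h5 := h1.unique (by rw [h3]; exact h4)
  have h6 := congrFun h3 τ
  simp only [Pi.add_apply, id_eq] at h5
  rw [← h6] at h5
  rw [mul_comm (Complex.I * _), h5]
  simp only [Complex.ofReal_one, one_mul]
  ring

theorem sum_Ioi_add_swap (g : Fin n → Fin n → ℝ) :
    ∑ j, ∑ k ∈ Finset.Ioi j, (g j k + g k j) = ∑ j, ∑ k ∈ Finset.univ.erase j, g j k := by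
  simp only [Finset.sum_add_distrib]
  have h : ∑ j, ∑ k ∈ Finset.Ioi j, g k j = ∑ j, ∑ k ∈ Finset.Iio j, g j k :=
    Finset.sum_comm' (by simp)
  rw [h, ← Finset.sum_add_distrib]
  refine Finset.sum_congr rfl fun j _ => ?_
  rw [← Finset.sum_union (Finset.disjoint_left.2 fun k h1 h2 =>
    lt_asymm (Finset.mem_Ioi.1 h1) (Finset.mem_Iio.1 h2))]
  refine Finset.sum_congr ?_ fun _ _ => rfl
  ext k
  simp only [Finset.mem_union, Finset.mem_Ioi, Finset.mem_Iio, Finset.mem_erase, Finset.mem_univ,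
    and_true]
  exact or_comm.trans lt_or_lt_iff_ne

theorem differentiableAt_circleEnergy {N : Polynomial ℂ} (hN : IsCirclePositive n N) {c : ℂ}
    (hc : c ≠ 0) (hfac : ∀ z, N.eval z = c * ∏ k, ((z - ζ k) * (z - circleReflection (ζ k))))
    {τ : EuclideanSpace ℝ (Fin n)} (hτ : Function.Injective (circlePoints τ)) :
    DifferentiableAt ℝ (circleEnergy ζ) τ := by
  have hlog : ∀ g : EuclideanSpace ℝ (Fin n) → ℂ, DifferentiableAt ℝ g τ → g τ ≠ 0 →
      DifferentiableAt ℝ (fun x => Real.log ‖g x‖) τ := fun g hg h0 =>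
    (hg.norm ℝ h0).log (norm_ne_zero_iff.2 h0)
  have hp : ∀ j : Fin n, DifferentiableAt ℝ (fun x => circlePoints x j) τ := fun j =>
    ((Complex.ofRealCLM.differentiableAt.comp τ
      (EuclideanSpace.proj (𝕜 := ℝ) j).differentiableAt).mul_const Complex.I).cexp
  have e : circleEnergy ζ = fun x => ∑ j, Real.log ‖N.eval (circlePoints x j)‖ -
      n * Real.log ‖c‖ -
      2 * ∑ j, ∑ k ∈ Finset.Ioi j, Real.log ‖circlePoints x j - circlePoints x k‖ :=
    funext fun x => energy_eq hN hc hfac (norm_circlePoints x)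
  rw [e]
  refine ((DifferentiableAt.fun_sum fun j _ => hlog _ ?_ ?_).sub_const _).sub
    ((DifferentiableAt.fun_sum fun j _ => DifferentiableAt.fun_sum fun k hk =>
      hlog _ ((hp j).sub (hp k)) ?_).const_mul 2)
  · exact ((N.differentiable.restrictScalars ℝ).differentiableAt).comp τ (hp j)
  · exact hN.eval_ne_zero _ (norm_circlePoints τ j)
  · exact sub_ne_zero.2 fun h => (Finset.mem_Ioi.1 hk).ne (hτ h)

/-- The real part of `z / (z - w)` is `1 / 2` on the unit circle. -/
theorem re_I_mul_div_sub {z w : ℂ} (hz : ‖z‖ = 1) (hw : ‖w‖ = 1) (h : z ≠ w) :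
    Complex.I * z / (z - w) = ((Complex.I * z / (z - w)).re : ℂ) + Complex.I / 2 := by
  have hz0 : z ≠ 0 := fun h => by simp [h] at hz
  have hw0 : w ≠ 0 := fun h => by simp [h] at hw
  have h1 : z - w ≠ 0 := sub_ne_zero.2 h
  have h2 : w - z ≠ 0 := sub_ne_zero.2 h.symm
  rw [Complex.re_eq_add_conj]
  simp only [map_div₀, map_mul, map_sub, Complex.conj_I, ← Complex.inv_eq_conj hz,
    ← Complex.inv_eq_conj hw]
  have h3 : z⁻¹ - w⁻¹ ≠ 0 := sub_ne_zero.2 fun e => h (inv_injective e)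
  have h4 : -Complex.I * z⁻¹ / (z⁻¹ - w⁻¹) = Complex.I * w / (z - w) := by
    rw [div_eq_div_iff h3 h1]
    field_simp
    ring
  rw [h4]
  field_simp
  ring

/-- The vanishing of the gradient is the tangential part of the equilibrium equations. The radial
parts of both sides are equal to `n - 1`. -/
theorem isEquilibrium_of_gradient_eq_zero {N : Polynomial ℂ} (hN : IsCirclePositive n N) {c : ℂ}
    (hc : c ≠ 0) (hfac : ∀ z, N.eval z = c * ∏ k, ((z - ζ k) * (z - circleReflection (ζ k))))
    {τ : EuclideanSpace ℝ (Fin n)} (hτ : Function.Injective (circlePoints τ))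
    (hgrad : gradient (circleEnergy ζ) τ = 0) : IsEquilibrium N (circlePoints τ) := by
  classical
  intro i
  set w := circlePoints τ with hw
  have hw1 : ∀ j, ‖w j‖ = 1 := norm_circlePoints τ
  have hfd : HasFDerivAt (circleEnergy ζ) (0 : EuclideanSpace ℝ (Fin n) →L[ℝ] ℝ) τ := by
    have h1 := (differentiableAt_circleEnergy hN hc hfac hτ).hasGradientAt.hasFDerivAt
    rwa [hgrad, map_zero] at h1
  -- The line through `τ` in the `i`-th coordinate direction.
  set γ : ℝ → EuclideanSpace ℝ (Fin n) := fun t => τ + t • EuclideanSpace.single i (1 : ℝ) with hγ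
  have hγ0 : γ 0 = τ := by simp [hγ]
  have hγ' : HasDerivAt γ (EuclideanSpace.single i (1 : ℝ)) 0 := by
    have := ((hasDerivAt_id (0 : ℝ)).smul_const (EuclideanSpace.single i (1 : ℝ))).const_add τ
    exact this.congr_deriv (one_smul _ _)
  have hzero : HasDerivAt (fun t => circleEnergy ζ (γ t)) 0 0 := by
    have := HasFDerivAt.comp_hasDerivAt (0 : ℝ) (by rw [hγ0]; exact hfd) hγ'
    exact this
  set u : Fin n → ℝ := fun j => if j = i then 1 else 0 with hu
  have hcoord : ∀ j, HasDerivAt (fun t => γ t j) (u j) 0 := by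
    intro j
    have e : (fun t => γ t j) = fun t => τ j + t * u j := by
      funext t
      simp [hγ, hu]
    rw [e]
    simpa using ((hasDerivAt_id (0 : ℝ)).mul_const (u j)).const_add (τ j)
  have hpt : ∀ j, HasDerivAt (fun t => circlePoints (γ t) j) (u j * (Complex.I * w j)) 0 := by
    intro j
    have h1 := (hasDerivAt_exp_mul_I (γ 0 j)).scomp (0 : ℝ) (hcoord j)
    rw [hγ0] at h1
    exact h1
  choose F hF hFN using fun j => hasDerivAt_log_norm_eval hN (τ j)
  have hone : ∀ j, HasDerivAt (fun t => Real.log ‖N.eval (circlePoints (γ t) j)‖) (F j * u j) 0 := by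
    intro j
    have h1 := HasDerivAt.comp (0 : ℝ) (by rw [hγ0]; exact hF j) (hcoord j)
    exact h1
  set g : Fin n → Fin n → ℝ := fun j k => u j * (Complex.I * w j / (w j - w k)).re with hg
  have htwo : ∀ j, ∀ k ∈ Finset.Ioi j, HasDerivAt
      (fun t => Real.log ‖circlePoints (γ t) j - circlePoints (γ t) k‖) (g j k + g k j) 0 := by
    intro j k hk
    have hne : w j - w k ≠ 0 := sub_ne_zero.2 fun h => (Finset.mem_Ioi.1 hk).ne (hτ h)
    have hne' : w k - w j ≠ 0 := sub_ne_zero.2 fun h => (Finset.mem_Ioi.1 hk).ne' (hτ h)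
    have h1 := hasDerivAt_log_norm ((hpt j).sub (hpt k)) (by
      rw [Pi.sub_apply, hγ0]; exact hne)
    refine h1.congr_deriv ?_
    rw [Pi.sub_apply, hγ0, hg]
    simp only
    rw [← Complex.re_ofReal_mul, ← Complex.re_ofReal_mul, ← Complex.add_re]
    congr 1
    change _ / (w j - w k) = _
    rw [← neg_sub (w j) (w k)]
    field_simp
    ring
  have hder := ((HasDerivAt.fun_sum fun j (_ : j ∈ Finset.univ) => hone j).sub_const
    (n * Real.log ‖c‖)).sub ((HasDerivAt.fun_sum fun j (_ : j ∈ Finset.univ) =>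
      HasDerivAt.fun_sum fun k hk => htwo j k hk).const_mul 2)
  have e : (fun t => circleEnergy ζ (γ t)) = _ :=
    funext fun t => energy_eq hN hc hfac (norm_circlePoints (γ t))
  rw [e] at hzero
  have hcrit := hzero.unique hder
  have hsum : ∑ j, ∑ k ∈ Finset.univ.erase j, g j k =
      ∑ k ∈ Finset.univ.erase i, (Complex.I * w i / (w i - w k)).re := by
    rw [Finset.sum_eq_single i (fun j _ hj => by simp [hg, hu, hj]) (by simp)]
    simp [hg, hu]
  have hFu : ∑ j, F j * u j = F i := by simp [hu]
  rw [sum_Ioi_add_swap, hsum, hFu] at hcrit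
  have hi0 : Complex.I * w i ≠ 0 :=
    mul_ne_zero Complex.I_ne_zero fun h => by have := hw1 i; simp [h] at this
  refine mul_left_cancel₀ hi0 ?_
  have h1 : Complex.I * w i * ∑ k ∈ Finset.univ.erase i, 1 / (w i - w k) =
      ((∑ k ∈ Finset.univ.erase i, (Complex.I * w i / (w i - w k)).re : ℝ) : ℂ) +
        ((n - 1 : ℕ) : ℂ) * (Complex.I / 2) := by
    rw [Finset.mul_sum, Complex.ofReal_sum]
    have hcard : (Finset.univ.erase i).card = n - 1 := by simp
    rw [← hcard, ← nsmul_eq_mul, ← Finset.sum_const, ← Finset.sum_add_distrib]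
    refine Finset.sum_congr rfl fun k hk => ?_
    rw [mul_one_div]
    exact re_I_mul_div_sub (hw1 i) (hw1 k) fun h => Finset.ne_of_mem_erase hk (hτ h).symm
  have h2 := hFN i
  change Complex.I * w i * N.derivative.eval (w i) = _ * N.eval (w i) at h2
  have h3 : F i = 2 * ∑ k ∈ Finset.univ.erase i, (Complex.I * w i / (w i - w k)).re := by
    linarith
  rw [h2, h3]
  push_cast at h1 ⊢
  linear_combination (-2 * N.eval (w i)) * h1

theorem isOpen_orderedAngles (n : ℕ) : IsOpen (orderedAngles n) := by
  have hc : ∀ j : Fin n, Continuous fun τ : EuclideanSpace ℝ (Fin n) => τ j := fun j =>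
    (EuclideanSpace.proj (𝕜 := ℝ) j).continuous
  have e : orderedAngles n = (⋂ j, ⋂ k, {τ | j < k → τ j < τ k}) ∩
      ⋂ j, ⋂ k, {τ : EuclideanSpace ℝ (Fin n) | τ k < τ j + 2 * Real.pi} := by
    ext τ
    simp [orderedAngles]
  rw [e]
  refine (isOpen_iInter_of_finite fun j => isOpen_iInter_of_finite fun k => ?_).inter
    (isOpen_iInter_of_finite fun j => isOpen_iInter_of_finite fun k =>
      isOpen_lt (hc k) ((hc j).add continuous_const))
  by_cases hjk : j < k
  · simpa [hjk] using isOpen_lt (hc j) (hc k)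
  · simp [hjk]

theorem IsSolutionPath.isEquilibrium {α : ℝ} {T : ℝ → EuclideanSpace ℝ (Fin n)}
    (hT : IsSolutionPath a α T) (ha : ∀ k, ‖a k‖ < 1) (δ : ℝ) :
    IsEquilibrium (critPoly a) (circlePoints (T δ)) :=
  isEquilibrium_of_blaschke_eq (injective_circlePoints (hT.mem_orderedAngles δ))
    (fun j => eval_blaschkeDen_ne_zero ha (norm_circlePoints (T δ) j).le) (hT.solution δ)

theorem IsSolutionPath.circleEnergy_le {α : ℝ} {T : ℝ → EuclideanSpace ℝ (Fin n)}
    (hT : IsSolutionPath a α T) (hζ : IsCriticalList a ζ) (hn : 0 < n) (ha : ∀ k, ‖a k‖ < 1)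
    (hB : deriv (blaschke a) 0 ≠ 0) (δ : ℝ) {τ : EuclideanSpace ℝ (Fin n)}
    (hτ : Function.Injective (circlePoints τ)) : circleEnergy ζ (T δ) ≤ circleEnergy ζ τ := by
  obtain ⟨c, hc, hfac⟩ := hζ.eval_critPoly hn ha hB
  exact ((hT.isEquilibrium ha δ).energy_le (isCirclePositive_critPoly hn ha) hc hfac
    (injective_circlePoints (hT.mem_orderedAngles δ)) (norm_circlePoints _) hτ
    (norm_circlePoints _)).1

theorem IsSolutionPath.gradient_eq_zero {α : ℝ} {T : ℝ → EuclideanSpace ℝ (Fin n)}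
    (hT : IsSolutionPath a α T) (hζ : IsCriticalList a ζ) (hn : 0 < n) (ha : ∀ k, ‖a k‖ < 1)
    (hB : deriv (blaschke a) 0 ≠ 0) (δ : ℝ) : gradient (circleEnergy ζ) (T δ) = 0 := by
  have hmin : IsLocalMin (circleEnergy ζ) (T δ) := by
    filter_upwards [(isOpen_orderedAngles n).mem_nhds (hT.mem_orderedAngles δ)] with τ hτ
    exact hT.circleEnergy_le hζ hn ha hB δ (injective_circlePoints hτ)
  rw [gradient, hmin.fderiv_eq_zero, map_zero]

/-- A critical point has the same energy as the level set of `B` through its first point, so by the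
case of equality it is this level set. -/
theorem IsSolutionPath.eq_of_gradient_eq_zero {α : ℝ} {T : ℝ → EuclideanSpace ℝ (Fin n)}
    (hT : IsSolutionPath a α T) (hζ : IsCriticalList a ζ) (hn : 0 < n) (ha : ∀ k, ‖a k‖ < 1)
    (hB : deriv (blaschke a) 0 ≠ 0) (hα : blaschke a 1 = Complex.exp (α * Complex.I))
    {τ : EuclideanSpace ℝ (Fin n)} (hτ : τ ∈ orderedAngles n)
    (hgrad : gradient (circleEnergy ζ) τ = 0) :
    τ = T (blaschkeAngle a α (τ ⟨0, hn⟩)) := by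
  obtain ⟨c, hc, hfac⟩ := hζ.eval_critPoly hn ha hB
  have hN := isCirclePositive_critPoly hn ha
  have hinj := injective_circlePoints hτ
  have hmono := strictMono_blaschkeAngle hn ha α
  set δ := blaschkeAngle a α (τ ⟨0, hn⟩) with hδ
  have hTj := hT.blaschkeAngle_eq hn ha hα δ
  have h0 : τ ⟨0, hn⟩ = T δ ⟨0, hn⟩ := hmono.injective (by rw [hTj]; simp [hδ])
  have hle := hT.circleEnergy_le hζ hn ha hB δ hinj
  have hge := ((isEquilibrium_of_gradient_eq_zero hN hc hfac hinj hgrad).energy_le hN hc hfac hinj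
    (norm_circlePoints τ) (injective_circlePoints (hT.mem_orderedAngles δ))
    (norm_circlePoints (T δ))).1
  have hrange := ((hT.isEquilibrium ha δ).energy_le hN hc hfac
    (injective_circlePoints (hT.mem_orderedAngles δ)) (norm_circlePoints _) hinj
    (norm_circlePoints _)).2 (le_antisymm hle hge) ⟨0, hn⟩ (by rw [circlePoints, h0]; rfl)
  have hval : ∀ j, blaschke a (Complex.exp (τ j * Complex.I)) = Complex.exp (δ * Complex.I) := by
    intro j
    obtain ⟨k, hk⟩ := hrange j
    rw [← hT.solution δ k]
    exact congrArg (blaschke a) hk.symm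
  have hang := blaschkeAngle_eq_of_blaschke_eq hn ha hα hτ fun j => by rw [hval, hval]
  ext j
  exact hmono.injective (by rw [hang, hTj])

end Energy

theorem theorem1 (n : ℕ) (a : Fin n → ℂ) (ha : ∀ k, ‖a k‖ < 1)
    (hB : deriv (blaschke a) 0 ≠ 0)
    (α : ℝ) (hα : α ∈ Set.Ico (-Real.pi) Real.pi)
    (hα1 : blaschke a 1 = Complex.exp (α * Complex.I)) :
    (∃ ζ : Fin (n - 1) → ℂ, IsCriticalList a ζ) ∧
    (∃ T : ℝ → EuclideanSpace ℝ (Fin n), IsSolutionPath a α T) ∧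
    ∀ (ζ : Fin (n - 1) → ℂ) (T : ℝ → EuclideanSpace ℝ (Fin n)),
      IsCriticalList a ζ → IsSolutionPath a α T →
      (∀ τ ∈ orderedAngles n ∩ solutionBox α T,
        DifferentiableAt ℝ (circleEnergy ζ) τ ∧
        (gradient (circleEnergy ζ) τ = 0 ↔
          ∃ δ ∈ Set.Ico α (α + 2 * n * Real.pi), τ = T δ)) ∧
      (∀ δ : ℝ, IsMinOn (extendedCircleEnergy ζ) Set.univ (T δ)) := by
  have hn : 0 < n := by
    rcases Nat.eq_zero_or_pos n with rfl | h
    -- The empty product is constant, so its derivative vanishes.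
    · refine absurd ?_ hB
      have : blaschke a = fun _ => 1 := funext fun z => by simp [blaschke]
      rw [this, deriv_const]
    · exact h
  refine ⟨exists_isCriticalList hn ha hB, exists_isSolutionPath hn ha hα1,
    fun ζ T hζ hT => ⟨fun τ ⟨hτ, hQ⟩ => ⟨?_, fun hgrad => ?_, ?_⟩, fun δ => ?_⟩⟩
  · obtain ⟨c, hc, hfac⟩ := hζ.eval_critPoly hn ha hB
    exact differentiableAt_circleEnergy (isCirclePositive_critPoly hn ha) hc hfac
      (injective_circlePoints hτ)
  · refine ⟨_, ?_, hT.eq_of_gradient_eq_zero hζ hn ha hB hα1 hτ hgrad⟩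
    have hmono := strictMono_blaschkeAngle hn ha α
    have h0 := hQ ⟨0, hn⟩
    rw [hT.first_eq_zero _ rfl] at h0
    have h1 := hmono.monotone h0.1
    have h2 := hmono h0.2
    rw [blaschkeAngle_add_two_pi] at h2
    rw [blaschkeAngle_zero] at h1 h2
    exact ⟨h1, by linarith⟩
  · rintro ⟨δ, -, rfl⟩
    exact hT.gradient_eq_zero hζ hn ha hB δ
  · intro τ _
    change extendedCircleEnergy ζ (T δ) ≤ extendedCircleEnergy ζ τ
    rw [extendedCircleEnergy, extendedCircleEnergy,
      if_pos (injective_circlePoints (hT.mem_orderedAngles δ))]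
    split_ifs with h
    · exact EReal.coe_le_coe_iff.2 (hT.circleEnergy_le hζ hn ha hB δ h)
    · exact le_top
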